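/- **Setting.** Let $c,G>0$. On $\mathfrak I^+\cong\mathbb R\times S^2$, with Bondi time $u_{\rm B}$ and stereographic coordinate $\zeta=e^{i\phi}\cot(\theta/2)$, put $P=1+\zeta\bar\zeta$ and, on functions of spin weight $s$, $\eth\eta=P^{1-s}\partial_\zeta(P^s\eta)$, $\bar\eth\eta=P^{1+s}\partial_{\bar\zeta}(P^{-s}\eta)$. Let $Y^0_{1i}=\frac{\sqrt2}{P}(\zeta+\bar\zeta,-i(\zeta-\bar\zeta),\zeta\bar\zeta-1)$ and $Y^1_{1i}=-\frac1{\sqrt2P}(1-\bar\zeta^2,-i(1+\bar\zeta^2),2\bar\zeta)$ be the $l=1$ harmonics of spin weight $0$ and $1$, let $\hat l^a=(\frac1{\sqrt2},\frac12Y^0_{1i})$, with index lowered by $\mathrm{diag}(1,-1,-1,-1)$, and write $f|_{l=1}$ for the $l=1$ part of a spin-weight-one function. An *asymptotically stationary vacuum spacetime* is given by its asymptotic data in a Bondi frame: smooth fields $\sigma^0,\psi_0^0,\psi_1^0,\psi_2^0,\psi_3^0,\psi_4^0$ on $\mathfrak I^+$, of spin weights $2,2,1,0,-1,-2$, independent of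 $u_{\rm B}$, which satisfy the asymptotic vacuum equations $$\psi_4^0=-\ddot{\bar\sigma}{}^0,\quad \psi_3^0=\eth\dot{\bar\sigma}{}^0,\quad \Psi:=\psi_2^0+\eth^2\bar\sigma^0+\sigma^0\dot{\bar\sigma}{}^0=\bar\Psi,$$ $$\dot\psi_2^0=-\eth\psi_3^0+\sigma^0\psi_4^0,\quad \dot\psi_1^0=-\eth\psi_2^0+2\sigma^0\psi_3^0,\quad \dot\psi_0^0=-\eth\psi_1^0+3\sigma^0\psi_2^0 .$$ The Bondi mass is $M_{\rm B}=-\frac{c^2}{2\sqrt2G}\Psi^0$, with $\Psi^0$ the mean of $\Psi$ over the sphere. The complex dipole is $D_{\mathbb C}^i=D^i_{\rm (mass)}+ic^{-1}J^i=-\frac{c^2}{6\sqrt2G}\psi_1^{0i}$, with $\psi_1^{0i}$ the coefficient of $Y^1_{1i}$ in $\psi_1^0$ and $D^i_{\rm (mass)},J^i$ real. The magnetic part of $\sigma^0=\eth^2(e+ib)$, with $e,b$ real and smooth, is $i\,\eth^2b$; the electric part is $\eth^2e$. A supertranslation $\hat u_{\rm B}=u_{\rm B}+\alpha(\zeta,\bar\zeta)$,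 with $\alpha$ real and smooth on $S^2$, gives $\hat\sigma^0=\sigma^0+\eth^2\alpha$ and the Weyl components obtained by the null rotation about $n^a$ with $L=-\eth\alpha$; the null rotation with angle field $L$ takes $\psi_1^0$ to $$\psi_1^{*0}=\psi_1^0-3L\psi_2^0+3L^2\psi_3^0-L^3\psi_4^0 .$$ A good cut function (GCF) is a family $u_{\rm B}=X(\tau,\zeta,\bar\zeta)$, with $\tau$ in a connected open set $U\subseteq\mathbb C$, that is holomorphic and injective in $\tau$, takes every real value for each $\zeta$, is smooth on the sphere and satisfies $\eth_{(\tau)}^2X=\sigma^0$. Its angle field is $L=\eth_{(\tau)}X$. It is the universal cut function (UCF) if $\psi_1^{*0}|_{l=1}=0$ on every cut $\tau=\mathrm{const}$. **Theorem.** For an asymptotically stationary vacuum spacetime: 1. $\psi_3^0=\psi_4^0=0$, $\eth\psi_2^0=0$, $\eth\psi_1^0=3\sigma^0\psi_2^0$ and $\psi_2^0+\eth^2\bar\sigma^0=\bar\psi_2^0+\bar\eth^2\sigma^0$; moreover $M_{\rm B}$ is constant and $\psi_2^0=-\frac{2\sqrt2G}{c^2}M_{\rm B}$. 2. $\sigma^0$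 has a decomposition into an electric and a magnetic part, and in every such decomposition the magnetic part is zero. There is a supertranslation after which $\sigma^0=0$. 3. In every frame with $\sigma^0=0$ obtained by a supertranslation, the data again satisfy the stationary vacuum equations with the same $M_{\rm B}$ and $\psi_2^0$, and $\psi_1^0=-\frac{6\sqrt2G}{c^2}\sum_iD_{\mathbb C}^iY^1_{1i}$ is pure $l=1$. The regular solutions of $\eth^2g=\sigma^0=0$ are exactly the functions $\xi^a\hat l_a=\frac{\xi^0}{\sqrt2}-\frac12\sum_i\xi^iY^0_{1i}$, with unique $\xi\in\mathbb C^4$, and $\eth(\xi^a\hat l_a)=\sum_i\xi^iY^1_{1i}$. Every GCF is $X=\xi^a(\tau)\hat l_a$ with a holomorphic world line $\xi^a(\tau)$. For each $\tau$, $\psi_1^{*0}|_{l=1}=0$ on the cut $\tau$ if and only if $\psi_1^{*0}=0$ there, if and only if $D_{\mathbb C}^i=M_{\rm B}\xi^i(\tau)$. Also $\psi_1^{*0}=0$ at all real points of $\mathfrak I^+$ if and only if $D_{\mathbb C}^i=M_{\rm B}\xi^i(\tau)$ for all $\tau\in U$. 4. Suppose in addition $M_{\rm B}\ne0$. In each such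 frame a UCF exists, and every UCF has constant spatial part $\xi^i=\xi_R^i+i\xi_I^i=D_{\mathbb C}^i/M_{\rm B}$ and injective holomorphic $\xi^0(\tau)$; thus $D_{\rm (mass)}^i=M_{\rm B}\xi_R^i$ and $J^i=M_{\rm B}c\,\xi_I^i$. The real translation by $(0,-\xi_R^i)$ followed by a suitable rotation leads to a Bondi frame, with the same $M_{\rm B}$, with $\sigma^0=0$, and again stationary vacuum, in which, in the gauge $\xi^0(\tau)=\tau$, the world line of every UCF is $$\xi^a(\tau)=(\tau,0,0,i\xi^3),\qquad \xi^3=|\xi_I|\ge0,$$ so that $u_{\rm B}=\frac{\tau}{\sqrt2}-\frac i2\xi^3Y^0_{1,3}$ and $L=i\xi^3Y^1_{1,3}$. This is a UCF of the new frame, with $\psi_1^{*0}=0$ identically, and there $D^i_{\rm (mass)}=0$ and $J^i=M_{\rm B}c\,(0,0,\xi^3)$. 5. These $l=0,1$ moments $(M_{\rm B},D_{\rm (mass)},J)$ of the new frame are the mass, mass dipole and angular momentum of the Kerr metric with mass $M_{\rm B}$ and rotation parameter $a=\xi^3$. Here they are read off, as $r\to\infty$ in Boyer–Lindquist coordinates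 $(ct,r,\theta,\phi)$ with unit vectors $n,e_\theta,e_\phi$ and signature $(+,-,-,-)$, from $$g_{tt}=1-\tfrac{2GM}{c^2r}+\tfrac{1}{r^2}\bigl(s-\tfrac{2G}{c^2}D\cdot n\bigr)+O(r^{-3}),$$ $$g_{t\theta}=\tfrac{2G}{c^3r}J\cdot e_\phi+O(r^{-2}),\qquad g_{t\phi}=-\tfrac{2G}{c^3r}\sin\theta\,J\cdot e_\theta+O(r^{-2}),$$ with $s$ a constant. -/

import Mathlib

open Complex MeasureTheory Filter Topology Asymptotics
open scoped ContDiff ComplexConjugate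

noncomputable section

/-! ### Spin-weighted functions on the sphere in the stereographic coordinate

The sphere is described by `ζ = e^{iφ} cot(θ/2) ∈ ℂ`, the missing pole being `ζ = ∞`. -/

/-- The conformal factor `P = 1 + ζ ζ̄`. -/
def sphereP (ζ : ℂ) : ℂ := 1 + ζ * conj ζ

/-- The Wirtinger derivative `∂/∂ζ`. -/
def dZeta (f : ℂ → ℂ) (ζ : ℂ) : ℂ :=
  (1 / 2) * (fderiv ℝ f ζ 1 - I * fderiv ℝ f ζ I)

/-- The Wirtinger derivative `∂/∂ζ̄`. -/
def dZetaBar (f : ℂ → ℂ) (ζ : ℂ) : ℂ :=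
  (1 / 2) * (fderiv ℝ f ζ 1 + I * fderiv ℝ f ζ I)

/-- `ð η = P^{1-s} ∂(P^s η)/∂ζ` on functions of spin weight `s`. -/
def eth (s : ℤ) (η : ℂ → ℂ) (ζ : ℂ) : ℂ :=
  sphereP ζ ^ (1 - s) * dZeta (fun z => sphereP z ^ s * η z) ζ

/-- `ð̄ η = P^{1+s} ∂(P^{-s} η)/∂ζ̄` on functions of spin weight `s`. -/
def ethBar (s : ℤ) (η : ℂ → ℂ) (ζ : ℂ) : ℂ :=
  sphereP ζ ^ (1 + s) * dZetaBar (fun z => sphereP z ^ (-s) * η z) ζ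

/-- `η` is a smooth function of spin weight `s` on the whole sphere: it is smooth in `ζ`, and its
expression in the rotated coordinate `-1/ζ` extends smoothly over the pole `ζ = ∞`. -/
def SmoothSpin (s : ℤ) (η : ℂ → ℂ) : Prop :=
  ContDiff ℝ ∞ η ∧ ∃ η' : ℂ → ℂ, ContDiff ℝ ∞ η' ∧
    ∀ ζ : ℂ, ζ ≠ 0 → η' (-1 / ζ) = (ζ / conj ζ) ^ s * η ζ

/-- The same for a field on `ℝ × S²` (Bondi time and sphere), jointly smooth. -/
def SmoothSpinField (s : ℤ) (η : ℝ → ℂ → ℂ) : Prop :=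
  ContDiff ℝ ∞ (fun p : ℝ × ℂ => η p.1 p.2) ∧
    ∃ η' : ℝ → ℂ → ℂ, ContDiff ℝ ∞ (fun p : ℝ × ℂ => η' p.1 p.2) ∧
      ∀ (u : ℝ) (ζ : ℂ), ζ ≠ 0 → η' u (-1 / ζ) = (ζ / conj ζ) ^ s * η u ζ

/-- The average of `f` over the unit sphere, whose area element is `4 d²ζ / P²`. -/
def sphereAvg (f : ℂ → ℂ) : ℂ :=
  (1 / Real.pi : ℂ) * ∫ ζ : ℂ, f ζ / sphereP ζ ^ 2

/-- The tensorial harmonics `Y⁰_{1i}`, `i = 1, 2, 3`. -/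
def Y10 (i : Fin 3) (ζ : ℂ) : ℂ :=
  (√2 : ℂ) / sphereP ζ * ![ζ + conj ζ, -I * (ζ - conj ζ), ζ * conj ζ - 1] i

/-- The tensorial harmonics `Y¹_{1i} = m_i`, `i = 1, 2, 3`. -/
def Y11 (i : Fin 3) (ζ : ℂ) : ℂ :=
  -1 / ((√2 : ℂ) * sphereP ζ) * ![1 - conj ζ ^ 2, -I * (1 + conj ζ ^ 2), 2 * conj ζ] i

/-- The coefficient of `Y¹_{1i}` in the harmonic expansion of a spin-weight-one function
(`Y¹_{1i}` and `Y¹_{1j}` are orthogonal for `i ≠ j`, and `|Y¹_{1i}|²` has average `1/3`). -/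
def l1Coeff (η : ℂ → ℂ) (i : Fin 3) : ℂ :=
  3 * sphereAvg (fun ζ => η ζ * conj (Y11 i ζ))

/-- The null vector `l̂ᵃ(ζ, ζ̄)`, with upper index. -/
def lHat (ζ : ℂ) : Fin 4 → ℂ := fun a =>
  (√2 : ℂ) / (2 * sphereP ζ) *
    ![1 + ζ * conj ζ, ζ + conj ζ, I * conj ζ - I * ζ, -1 + ζ * conj ζ] a

/-- The flat cut function `ξᵃ l̂_a(ζ, ζ̄)`, the index lowered with `diag(1,-1,-1,-1)`. -/
def flatCut (ξ : Fin 4 → ℂ) (ζ : ℂ) : ℂ :=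
  ξ 0 * lHat ζ 0 - ∑ i : Fin 3, ξ i.succ * lHat ζ i.succ

/-! ### Asymptotic Bondi data on future null infinity -/

/-- The asymptotic fields on `ℐ⁺` in a Bondi frame, as functions of `(u_B, ζ)`: the Bondi shear
`σ⁰` and the leading Weyl tensor components `ψ₀⁰, …, ψ₄⁰`. -/
structure ScriData where
  σ : ℝ → ℂ → ℂ
  ψ0 : ℝ → ℂ → ℂ
  ψ1 : ℝ → ℂ → ℂ
  ψ2 : ℝ → ℂ → ℂ
  ψ3 : ℝ → ℂ → ℂ
  ψ4 : ℝ → ℂ → ℂ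

/-- The derivative with respect to Bondi time. -/
def uDot (f : ℝ → ℂ → ℂ) (u : ℝ) (ζ : ℂ) : ℂ := deriv (fun v => f v ζ) u

namespace ScriData

/-- The complex conjugate shear (spin weight `-2`). -/
def σbar (d : ScriData) (u : ℝ) (ζ : ℂ) : ℂ := conj (d.σ u ζ)

/-- The mass aspect `Ψ = ψ₂⁰ + ð²σ̄⁰ + σ⁰ ∂_u σ̄⁰`. -/
def massAspect (d : ScriData) (u : ℝ) (ζ : ℂ) : ℂ :=
  d.ψ2 u ζ + eth (-1) (eth (-2) (d.σbar u)) ζ + d.σ u ζ * uDot d.σbar u ζ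

/-- The vacuum equations at `ℐ⁺`: regularity on the sphere, the expressions of `ψ₃⁰` and `ψ₄⁰`
through the shear, the reality condition and the asymptotic Bianchi identities. -/
structure IsVacuum (d : ScriData) : Prop where
  smooth_σ : SmoothSpinField 2 d.σ
  smooth_ψ0 : SmoothSpinField 2 d.ψ0
  smooth_ψ1 : SmoothSpinField 1 d.ψ1
  smooth_ψ2 : SmoothSpinField 0 d.ψ2
  smooth_ψ3 : SmoothSpinField (-1) d.ψ3
  smooth_ψ4 : SmoothSpinField (-2) d.ψ4
  ψ4_eq : ∀ u ζ, d.ψ4 u ζ = -uDot (uDot d.σbar) u ζ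
  ψ3_eq : ∀ u ζ, d.ψ3 u ζ = eth (-2) (uDot d.σbar u) ζ
  reality : ∀ u ζ, conj (d.massAspect u ζ) = d.massAspect u ζ
  bianchi2 : ∀ u ζ, uDot d.ψ2 u ζ = -eth (-1) (d.ψ3 u) ζ + d.σ u ζ * d.ψ4 u ζ
  bianchi1 : ∀ u ζ, uDot d.ψ1 u ζ = -eth 0 (d.ψ2 u) ζ + 2 * d.σ u ζ * d.ψ3 u ζ
  bianchi0 : ∀ u ζ, uDot d.ψ0 u ζ = -eth 1 (d.ψ1 u) ζ + 3 * d.σ u ζ * d.ψ2 u ζ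

/-- Asymptotic stationarity: the asymptotic fields do not depend on Bondi time. -/
def IsStationary (d : ScriData) : Prop :=
  ∀ u v ζ, d.σ u ζ = d.σ v ζ ∧ d.ψ0 u ζ = d.ψ0 v ζ ∧ d.ψ1 u ζ = d.ψ1 v ζ ∧
    d.ψ2 u ζ = d.ψ2 v ζ ∧ d.ψ3 u ζ = d.ψ3 v ζ ∧ d.ψ4 u ζ = d.ψ4 v ζ

/-- `ψ₁*⁰`, after the null rotation about `nᵃ` with angle field `L` (a function on the sphere),
at Bondi time `u`. -/
def nullRotPsi1 (d : ScriData) (L : ℂ → ℂ) (u : ℝ) (ζ : ℂ) : ℂ :=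
  d.ψ1 u ζ - 3 * L ζ * d.ψ2 u ζ + 3 * L ζ ^ 2 * d.ψ3 u ζ - L ζ ^ 3 * d.ψ4 u ζ

/-- The data in the Bondi frame with time `û = u + α(ζ, ζ̄)`. The shear changes by `ð²α`; the new
tetrad arises by the null rotation with `L = ð_{(û)}(û - α) = -ðα`, the new cuts being
`u = û - α`. -/
def supertranslate (d : ScriData) (α : ℂ → ℝ) : ScriData :=
  let L : ℂ → ℂ := fun ζ => -eth 0 (fun z => (α z : ℂ)) ζ
  { σ := fun u ζ => d.σ (u - α ζ) ζ + eth 1 (eth 0 (fun z => (α z : ℂ))) ζ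
    ψ0 := fun u ζ => d.ψ0 (u - α ζ) ζ - 4 * L ζ * d.ψ1 (u - α ζ) ζ
      + 6 * L ζ ^ 2 * d.ψ2 (u - α ζ) ζ - 4 * L ζ ^ 3 * d.ψ3 (u - α ζ) ζ
      + L ζ ^ 4 * d.ψ4 (u - α ζ) ζ
    ψ1 := fun u ζ => d.nullRotPsi1 L (u - α ζ) ζ
    ψ2 := fun u ζ => d.ψ2 (u - α ζ) ζ - 2 * L ζ * d.ψ3 (u - α ζ) ζ
      + L ζ ^ 2 * d.ψ4 (u - α ζ) ζ
    ψ3 := fun u ζ => d.ψ3 (u - α ζ) ζ - L ζ * d.ψ4 (u - α ζ) ζ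
    ψ4 := fun u ζ => d.ψ4 (u - α ζ) ζ }

end ScriData

/-- A supertranslation: a smooth real function on the whole sphere. -/
def IsSupertranslation (α : ℂ → ℝ) : Prop := SmoothSpin 0 (fun ζ => (α ζ : ℂ))

/-- The translation `α = bᵃ l̂_a` with real `bᵃ`. -/
def translation (b : Fin 4 → ℝ) (ζ : ℂ) : ℝ := (flatCut (fun a => (b a : ℂ)) ζ).re

/-- The splitting of a spin-weight-two function into its electric part `ð²e` and its magnetic part
`i ð²b`, with smooth real potentials `e`, `b`. -/
def IsElectricMagneticSplit (σ σE σM : ℂ → ℂ) : Prop :=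
  ∃ e b : ℂ → ℝ, SmoothSpin 0 (fun ζ => (e ζ : ℂ)) ∧ SmoothSpin 0 (fun ζ => (b ζ : ℂ)) ∧
    (∀ ζ, σE ζ = eth 1 (eth 0 (fun z => (e z : ℂ))) ζ) ∧
    (∀ ζ, σM ζ = I * eth 1 (eth 0 (fun z => (b z : ℂ))) ζ) ∧
    ∀ ζ, σ ζ = σE ζ + σM ζ

/-! ### Rotations -/

/-- The denominator `c ζ + d` of the fractional linear map of `A`. -/
def mobDenom (A : Matrix (Fin 2) (Fin 2) ℂ) (ζ : ℂ) : ℂ := A 1 0 * ζ + A 1 1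

/-- The fractional linear map `ζ ↦ (a ζ + b)/(c ζ + d)`. -/
def mob (A : Matrix (Fin 2) (Fin 2) ℂ) (ζ : ℂ) : ℂ := (A 0 0 * ζ + A 0 1) / mobDenom A ζ

/-- `η'` is the spin-weight-`s` function `η` in the rotated coordinate `ζ' = (a ζ + b)/(c ζ + d)`:
`η'(ζ') = e^{isλ} η(ζ)` with `e^{iλ} = (c ζ + d)/(c̄ ζ̄ + d̄)`. -/
def SpinRotated (A : Matrix (Fin 2) (Fin 2) ℂ) (s : ℤ) (η η' : ℂ → ℂ) : Prop :=
  ∀ ζ, mobDenom A ζ ≠ 0 →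
    η' (mob A ζ) = (mobDenom A ζ / conj (mobDenom A ζ)) ^ s * η ζ

/-- `d'` is the data `d` in the Bondi frame rotated by `A ∈ SU(2)` (so that `K = 1`). -/
def ScriData.IsRotated (A : Matrix (Fin 2) (Fin 2) ℂ) (d d' : ScriData) : Prop :=
  ∀ u, SpinRotated A 2 (d.σ u) (d'.σ u) ∧ SpinRotated A 2 (d.ψ0 u) (d'.ψ0 u) ∧
    SpinRotated A 1 (d.ψ1 u) (d'.ψ1 u) ∧ SpinRotated A 0 (d.ψ2 u) (d'.ψ2 u) ∧
    SpinRotated A (-1) (d.ψ3 u) (d'.ψ3 u) ∧ SpinRotated A (-2) (d.ψ4 u) (d'.ψ4 u)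

/-! ### Physical identifications (`c` velocity of light, `G` gravitational constant) -/

namespace ScriData

/-- The Bondi mass `M_B = -(c²/(2√2 G)) Ψ⁰`, `Ψ⁰` the `l = 0` part of the mass aspect. -/
def bondiMass (c G : ℝ) (d : ScriData) (u : ℝ) : ℝ :=
  -(c ^ 2 / (2 * √2 * G)) * (sphereAvg (d.massAspect u)).re

/-- The complex gravitational dipole `D_ℂ = -(c²/(6√2 G)) ψ₁⁰ⁱ`. -/
def complexDipole (c G : ℝ) (d : ScriData) (u : ℝ) (i : Fin 3) : ℂ :=
  -((c ^ 2 / (6 * √2 * G) : ℝ) : ℂ) * l1Coeff (d.ψ1 u) i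

/-- The mass dipole: `D_ℂ = D_mass + i c⁻¹ J`. -/
def massDipole (c G : ℝ) (d : ScriData) (u : ℝ) (i : Fin 3) : ℝ :=
  (d.complexDipole c G u i).re

/-- The angular momentum: `D_ℂ = D_mass + i c⁻¹ J`. -/
def angularMomentum (c G : ℝ) (d : ScriData) (u : ℝ) (i : Fin 3) : ℝ :=
  c * (d.complexDipole c G u i).im

end ScriData

/-! ### Good cut functions -/

/-- `u_B = X(τ, ζ, ζ̄)`, `τ ∈ U`, is a regular good cut function for the time-independent shear
`shear`: it is holomorphic in `τ`, regular on the sphere, solves `ð_{(τ)}² X = σ⁰`, and can be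
inverted for `τ` at all real values of `u_B`. -/
structure IsGCF (shear : ℂ → ℂ) (U : Set ℂ) (X : ℂ → ℂ → ℂ) : Prop where
  isOpen : IsOpen U
  isPreconnected : IsPreconnected U
  holomorphic : ∀ ζ, DifferentiableOn ℂ (fun τ => X τ ζ) U
  regular : ∀ τ ∈ U, SmoothSpin 0 (X τ)
  goodCut : ∀ τ ∈ U, ∀ ζ, eth 1 (eth 0 (X τ)) ζ = shear ζ
  injective : ∀ ζ, Set.InjOn (fun τ => X τ ζ) U
  real : ∀ ζ (u : ℝ), ∃ τ ∈ U, X τ ζ = u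

/-- `X` is the universal cut function of the (time-independent) data `d`: on every cut of
constant `τ`, the `l = 1` part of `ψ₁*⁰`, for the angle field `L = ð_{(τ)} X`, vanishes. -/
def ScriData.IsUCF (d : ScriData) (U : Set ℂ) (X : ℂ → ℂ → ℂ) : Prop :=
  ∀ τ ∈ U, ∀ (u : ℝ) (i : Fin 3), l1Coeff (d.nullRotPsi1 (eth 0 (X τ)) u) i = 0

/-! ### The Kerr metric and its `l = 0, 1` moments -/

/-- The Kerr metric in Boyer-Lindquist coordinates `(ct, r, θ, φ)`, signature `(+,-,-,-)`, with
`m = GM/c²` and rotation parameter `a`. -/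
def kerrMetric (m a r θ _φ : ℝ) : Matrix (Fin 4) (Fin 4) ℝ :=
  let S := r ^ 2 + a ^ 2 * Real.cos θ ^ 2
  let Δ := r ^ 2 - 2 * m * r + a ^ 2
  let k := 2 * m * a * r * Real.sin θ ^ 2 / S
  !![1 - 2 * m * r / S, 0, 0, k;
     0, -S / Δ, 0, 0;
     0, 0, -S, 0;
     k, 0, 0, -(r ^ 2 + a ^ 2 + 2 * m * a ^ 2 * r * Real.sin θ ^ 2 / S) * Real.sin θ ^ 2]

/-- A stationary metric `g(r, θ, φ)`, in coordinates `(ct, r, θ, φ)` and with signature `(+,-,-,-)`,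
has mass `M`, mass dipole `D` and angular momentum `J`: as `r → ∞`, with `n, e_θ, e_φ` the unit
vectors of the spherical coordinates,
`g_tt = 1 - 2GM/(c² r) + (s - 2G D·n/c²)/r² + O(r⁻³)` for some constant `s`, and
`g_tj dxʲ` has the angular part of `(2G/c³) (J × n)·dx/r²` to leading order. -/
def HasLowMoments (c G : ℝ) (g : ℝ → ℝ → ℝ → Matrix (Fin 4) (Fin 4) ℝ)
    (M : ℝ) (D J : Fin 3 → ℝ) : Prop :=
  ∃ s : ℝ, ∀ θ φ : ℝ,
    let n : Fin 3 → ℝ := ![Real.sin θ * Real.cos φ, Real.sin θ * Real.sin φ, Real.cos θ]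
    let eθ : Fin 3 → ℝ := ![Real.cos θ * Real.cos φ, Real.cos θ * Real.sin φ, -Real.sin θ]
    let eφ : Fin 3 → ℝ := ![-Real.sin φ, Real.cos φ, 0]
    ((fun r : ℝ => g r θ φ 0 0 - (1 - 2 * G * M / (c ^ 2 * r)
        + (s - 2 * G / c ^ 2 * ∑ i, D i * n i) / r ^ 2)) =O[atTop] fun r => (r ^ 3)⁻¹) ∧
    ((fun r : ℝ => g r θ φ 0 2 - 2 * G / (c ^ 3 * r) * ∑ i, J i * eφ i)
        =O[atTop] fun r => (r ^ 2)⁻¹) ∧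
    ((fun r : ℝ => g r θ φ 0 3 + 2 * G / (c ^ 3 * r) * Real.sin θ * ∑ i, J i * eθ i)
        =O[atTop] fun r => (r ^ 2)⁻¹)

end

/-!
Stationary vacuum data at null infinity have the mass, mass dipole and angular
momentum of a Kerr metric.

*Field equations.* Time independence leaves `ψ₃⁰ = ψ₄⁰ = 0`, `ðψ₂⁰ = 0` and `ðψ₁⁰ = 3σ⁰ψ₂⁰`. A smooth
function of spin weight `0` or `1` annihilated by `ð` becomes, after multiplication by a power of
`P`, an antiholomorphic function of polynomial growth, so by Liouville's theorem it is a constant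
(`exists_eq_const_of_eth_eq_zero`), respectively a combination of the `Y¹_{1i}`
(`exists_eq_sum_Y11_of_eth_eq_zero`). Hence `ψ₂⁰` is constant. It is real, and is the mean of the
mass aspect, because `ð²σ̄⁰` has mean zero by Stokes' theorem (`sphereAvg_eth_neg_one`).

*The shear.* Reality of the mass aspect now says that `ð̄²σ⁰` is real. With `σ⁰ = P q` and `e = f/P`
the equation `ð²e = σ⁰` is `∂²f = q`, and `ð̄²σ⁰ = P³ ∂̄²q`. The real function `f` is found by the
Poincaré lemma applied in turn to `∂∂̄f`, `∂f` and `f`, the reality of `∂̄²q` being the closedness of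
the first form. No elliptic theory is needed. On the overlap of the two stereographic charts, `P`
times the difference of the two potentials solves `∂²h = ∂̄²h = 0`. The difference is therefore a
combination of `l = 0, 1` harmonics, which is smooth on the whole sphere (`exists_potential`). The
supertranslation by `-e` removes the shear.

*Good cuts.* In a frame with `σ⁰ = 0` one has `ðψ₁⁰ = 0`, so `ψ₁⁰` is pure `l = 1`, and the regular
solutions of `ð²g = 0` are the flat cut functions (`exists_eq_flatCut_of_eth_eth_eq_zero`). The null
rotation to the cut with position `ξ` turns the dipole `D` into `D - M ξ` (`nullRotPsi1_flatCut`).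
Orthogonality of the `Y¹_{1i}` turns this into the equivalences with `D = M ξ`. Vanishing at the real
points suffices by the identity theorem, since by the open mapping theorem the real points of
`X(·, ζ)` accumulate (`IsGCF.eq_zero_of_real_points`).

*The canonical frame.* For `M ≠ 0` the universal cut function has position `D/M`. A translation
removes the real part, and an explicit element of `SU(2)` turns the imaginary part into the third
axis (`exists_rotation_to_axis`). Smoothness of the rotated fields is seen on the homogeneous
functions on `ℂ² ∖ {0}` that they induce (`SmoothSpin.exists_rotated`).
-/

/-! ### Wirtinger calculus -/

/-- The real-linear map `v ↦ p v + q v̄`, the differential with Wirtinger components `p` and `q`. -/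
noncomputable def wirtingerMap (p q : ℂ) : ℂ →L[ℝ] ℂ :=
  p • (ContinuousLinearMap.id ℝ ℂ) + q • (conjCLE : ℂ →L[ℝ] ℂ)

@[simp] lemma wirtingerMap_apply (p q v : ℂ) : wirtingerMap p q v = p * v + q * conj v := by
  simp [wirtingerMap]

/-- `f` is real differentiable at `z` with `∂f/∂ζ = p` and `∂f/∂ζ̄ = q`. -/
def HasWirtingerAt (f : ℂ → ℂ) (p q z : ℂ) : Prop := HasFDerivAt f (wirtingerMap p q) z

namespace HasWirtingerAt

variable {f g : ℂ → ℂ} {p q r s z : ℂ}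

lemma dZeta (h : HasWirtingerAt f p q z) : dZeta f z = p := by
  unfold HasWirtingerAt at h
  rw [_root_.dZeta, h.fderiv]
  simp only [wirtingerMap_apply, map_one, conj_I]
  linear_combination (-(1 / 2 : ℂ) * p + (1 / 2) * q) * I_sq

lemma dZetaBar (h : HasWirtingerAt f p q z) : dZetaBar f z = q := by
  unfold HasWirtingerAt at h
  rw [_root_.dZetaBar, h.fderiv]
  simp only [wirtingerMap_apply, map_one, conj_I]
  linear_combination ((1 / 2 : ℂ) * p - (1 / 2) * q) * I_sq

lemma differentiableAt (h : HasWirtingerAt f p q z) : DifferentiableAt ℝ f z :=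
  HasFDerivAt.differentiableAt h

lemma congr_deriv (h : HasWirtingerAt f p q z) (hp : p = r) (hq : q = s) :
    HasWirtingerAt f r s z := by
  subst hp hq; exact h

lemma congr_of_eventuallyEq (h : HasWirtingerAt f p q z) (hg : g =ᶠ[𝓝 z] f) :
    HasWirtingerAt g p q z :=
  HasFDerivAt.congr_of_eventuallyEq h hg

lemma const (c z : ℂ) : HasWirtingerAt (fun _ => c) 0 0 z :=
  (hasFDerivAt_const c z).congr_fderiv (by ext; simp)

lemma ident (z : ℂ) : HasWirtingerAt (fun w => w) 1 0 z :=
  (hasFDerivAt_id (𝕜 := ℝ) z).congr_fderiv (by ext; simp)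

protected lemma star (h : HasWirtingerAt f p q z) :
    HasWirtingerAt (fun w => conj (f w)) (conj q) (conj p) z :=
  (((conjCLE : ℂ →L[ℝ] ℂ).hasFDerivAt (x := f z)).comp z h).congr_fderiv
    (by ext v; simp [add_comm])

lemma add (hf : HasWirtingerAt f p q z) (hg : HasWirtingerAt g r s z) :
    HasWirtingerAt (fun w => f w + g w) (p + r) (q + s) z :=
  (HasFDerivAt.add hf hg).congr_fderiv (by ext v; simp; ring)

lemma mul (hf : HasWirtingerAt f p q z) (hg : HasWirtingerAt g r s z) :
    HasWirtingerAt (fun w => f w * g w) (p * g z + f z * r) (q * g z + f z * s) z :=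
  (HasFDerivAt.mul hf hg).congr_fderiv (by ext v; simp; ring)

lemma const_mul (c : ℂ) (hf : HasWirtingerAt f p q z) :
    HasWirtingerAt (fun w => c * f w) (c * p) (c * q) z :=
  ((const c z).mul hf).congr_deriv (by ring) (by ring)

lemma sub (hf : HasWirtingerAt f p q z) (hg : HasWirtingerAt g r s z) :
    HasWirtingerAt (fun w => f w - g w) (p - r) (q - s) z :=
  (HasFDerivAt.sub hf hg).congr_fderiv (by ext v; simp; ring)

/-- Chain rule with a holomorphic outer function. -/
lemma holomorphic_comp {φ : ℂ → ℂ} {φ' : ℂ} (hφ : HasDerivAt φ φ' (f z))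
    (hf : HasWirtingerAt f p q z) : HasWirtingerAt (fun w => φ (f w)) (φ' * p) (φ' * q) z :=
  ((hφ.hasFDerivAt.restrictScalars ℝ).comp z hf).congr_fderiv (by ext v; simp; ring)

/-- Chain rule with a holomorphic inner function. -/
lemma comp_holomorphic {φ : ℂ → ℂ} {φ' : ℂ} (hf : HasWirtingerAt f p q (φ z))
    (hφ : HasDerivAt φ φ' z) :
    HasWirtingerAt (fun w => f (φ w)) (p * φ') (q * conj φ') z :=
  (HasFDerivAt.comp z hf (hφ.hasFDerivAt.restrictScalars ℝ)).congr_fderiv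
    (by ext v; simp; ring)

lemma zpow (hf : HasWirtingerAt f p q z) (h0 : f z ≠ 0) (n : ℤ) :
    HasWirtingerAt (fun w => f w ^ n) (n * f z ^ (n - 1) * p) (n * f z ^ (n - 1) * q) z :=
  holomorphic_comp (hasDerivAt_zpow n (f z) (Or.inl h0)) hf

lemma inv (hf : HasWirtingerAt f p q z) (h0 : f z ≠ 0) :
    HasWirtingerAt (fun w => (f w)⁻¹) (-p / f z ^ 2) (-q / f z ^ 2) z :=
  (holomorphic_comp (hasDerivAt_inv h0) hf).congr_deriv (by field_simp) (by field_simp)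

lemma div (hf : HasWirtingerAt f p q z) (hg : HasWirtingerAt g r s z) (h0 : g z ≠ 0) :
    HasWirtingerAt (fun w => f w / g w) ((p * g z - f z * r) / g z ^ 2)
      ((q * g z - f z * s) / g z ^ 2) z :=
  (hf.mul (hg.inv h0)).congr_deriv (by field_simp; ring) (by field_simp; ring)

end HasWirtingerAt

lemma hasWirtingerAt_conj (z : ℂ) : HasWirtingerAt (fun w => conj w) 0 1 z :=
  (HasWirtingerAt.ident z).star.congr_deriv (by simp) (by simp)

lemma DifferentiableAt.hasWirtingerAt {f : ℂ → ℂ} {z : ℂ} (h : DifferentiableAt ℝ f z) :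
    HasWirtingerAt f (dZeta f z) (dZetaBar f z) z := by
  refine h.hasFDerivAt.congr_fderiv ?_
  ext v
  have hv : v = v.re • (1 : ℂ) + v.im • I := by simp
  rw [wirtingerMap_apply]
  conv_lhs => rw [hv]
  conv_rhs => rw [hv]
  rw [map_add, map_smul, map_smul]
  simp only [dZeta, dZetaBar, real_smul, map_add, map_mul, conj_ofReal, map_one, conj_I]
  linear_combination (v.im * fderiv ℝ f z I : ℂ) * I_sq

lemma Filter.EventuallyEq.dZeta_eq {f g : ℂ → ℂ} {z : ℂ} (h : f =ᶠ[𝓝 z] g) :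
    dZeta f z = dZeta g z := by
  simp only [dZeta, h.fderiv_eq]

lemma Filter.EventuallyEq.dZetaBar_eq {f g : ℂ → ℂ} {z : ℂ} (h : f =ᶠ[𝓝 z] g) :
    dZetaBar f z = dZetaBar g z := by
  simp only [dZetaBar, h.fderiv_eq]

lemma fderiv_conj_comp (f : ℂ → ℂ) (z v : ℂ) :
    fderiv ℝ (fun w => conj (f w)) z v = conj (fderiv ℝ f z v) := by
  have := (conjCLE : ℂ ≃L[ℝ] ℂ).comp_fderiv (f := f) (x := z)
  have h2 : (⇑conjCLE ∘ f) = fun w => conj (f w) := by ext w; simp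
  rw [h2] at this
  rw [this]; simp

lemma dZeta_conj (f : ℂ → ℂ) (z : ℂ) : dZeta (fun w => conj (f w)) z = conj (dZetaBar f z) := by
  simp [dZeta, dZetaBar, fderiv_conj_comp, sub_eq_add_neg, conj_ofNat]

lemma dZetaBar_conj (f : ℂ → ℂ) (z : ℂ) : dZetaBar (fun w => conj (f w)) z = conj (dZeta f z) := by
  simp [dZeta, dZetaBar, fderiv_conj_comp, sub_eq_add_neg, conj_ofNat]

lemma ContDiffAt.dZeta {f : ℂ → ℂ} {z : ℂ} (h : ContDiffAt ℝ ∞ f z) :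
    ContDiffAt ℝ ∞ (dZeta f) z := by
  have h1 : ContDiffAt ℝ ∞ (fderiv ℝ f) z := h.fderiv_right (by simp)
  exact contDiffAt_const.mul ((h1.clm_apply contDiffAt_const).sub
    (contDiffAt_const.mul (h1.clm_apply contDiffAt_const)))

lemma ContDiffAt.dZetaBar {f : ℂ → ℂ} {z : ℂ} (h : ContDiffAt ℝ ∞ f z) :
    ContDiffAt ℝ ∞ (dZetaBar f) z := by
  have h1 : ContDiffAt ℝ ∞ (fderiv ℝ f) z := h.fderiv_right (by simp)
  exact contDiffAt_const.mul ((h1.clm_apply contDiffAt_const).add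
    (contDiffAt_const.mul (h1.clm_apply contDiffAt_const)))

lemma ContDiff.dZeta {f : ℂ → ℂ} (h : ContDiff ℝ ∞ f) : ContDiff ℝ ∞ (dZeta f) :=
  contDiff_iff_contDiffAt.2 fun _ => h.contDiffAt.dZeta

lemma ContDiff.dZetaBar {f : ℂ → ℂ} (h : ContDiff ℝ ∞ f) : ContDiff ℝ ∞ (dZetaBar f) :=
  contDiff_iff_contDiffAt.2 fun _ => h.contDiffAt.dZetaBar

lemma ContDiffAt.hasWirtingerAt {f : ℂ → ℂ} {z : ℂ} (h : ContDiffAt ℝ ∞ f z) :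
    HasWirtingerAt f (_root_.dZeta f z) (_root_.dZetaBar f z) z :=
  (h.differentiableAt (by simp)).hasWirtingerAt

lemma ContDiff.hasWirtingerAt {f : ℂ → ℂ} (h : ContDiff ℝ ∞ f) (z : ℂ) :
    HasWirtingerAt f (_root_.dZeta f z) (_root_.dZetaBar f z) z :=
  h.contDiffAt.hasWirtingerAt

lemma dZeta_dZetaBar_comm {f : ℂ → ℂ} {z : ℂ} (h : ContDiffAt ℝ ∞ f z) :
    dZeta (dZetaBar f) z = dZetaBar (dZeta f) z := by
  have h1 : DifferentiableAt ℝ (fderiv ℝ f) z :=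
    (ContDiffAt.fderiv_right (m := ∞) h (by simp)).differentiableAt (by simp)
  have h2 : IsSymmSndFDerivAt ℝ f z := h.isSymmSndFDerivAt (by simpa using WithTop.coe_le_coe.2 (le_top : (2 : ℕ∞) ≤ ⊤))
  have e (v : ℂ) : HasFDerivAt (fun w => fderiv ℝ f w v)
      ((fderiv ℝ (fderiv ℝ f) z).flip v) z := by
    have := (h1.hasFDerivAt).clm_apply (hasFDerivAt_const v z)
    exact this.congr_fderiv (by ext; simp)
  have eA : HasFDerivAt (dZeta f) _ z := (((e 1).sub ((e I).const_mul I)).const_mul (1 / 2))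
  have eB : HasFDerivAt (dZetaBar f) _ z := (((e 1).add ((e I).const_mul I)).const_mul (1 / 2))
  rw [dZeta.eq_1 (dZetaBar f), dZetaBar.eq_1 (dZeta f), eA.fderiv, eB.fderiv]
  have h3 := h2.eq 1 I
  simp only [smul_apply, sub_apply, add_apply, ContinuousLinearMap.flip_apply, smul_eq_mul]
  rw [h3]
  ring

/-- A function on a connected open set with vanishing Wirtinger derivatives is constant. -/
lemma exists_const_of_wirtinger_eq_zero {S : Set ℂ} (hS : IsOpen S) (hc : IsPreconnected S)
    {f : ℂ → ℂ} (h : ∀ z ∈ S, HasWirtingerAt f 0 0 z) : ∃ a, ∀ z ∈ S, f z = a := by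
  refine hS.exists_is_const_of_fderiv_eq_zero (𝕜 := ℝ) hc
    (fun z hz => (h z hz).differentiableAt.differentiableWithinAt) fun z hz => ?_
  rw [HasFDerivAt.fderiv (h z hz)]
  ext; simp

/-- The functions annihilated by `∂²` and `∂̄²` on a connected open set are the combinations of
`1, ζ, ζ̄, ζζ̄`. -/
lemma exists_eq_bilinear_of_dZeta_sq_eq_zero {S : Set ℂ} (hS : IsOpen S) (hc : IsPreconnected S)
    {f : ℂ → ℂ} (hf : ∀ z ∈ S, ContDiffAt ℝ ∞ f z) (h1 : ∀ z ∈ S, dZeta (dZeta f) z = 0)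
    (h2 : ∀ z ∈ S, dZetaBar (dZetaBar f) z = 0) :
    ∃ a b b' c : ℂ, ∀ z ∈ S, f z = a + b * z + b' * conj z + c * (z * conj z) := by
  have comm : ∀ z ∈ S, dZeta (dZetaBar f) =ᶠ[𝓝 z] dZetaBar (dZeta f) := fun z hz =>
    (hS.eventually_mem hz).mono fun w hw => dZeta_dZetaBar_comm (hf w hw)
  have ev1 : ∀ z ∈ S, dZeta (dZeta f) =ᶠ[𝓝 z] fun _ => 0 := fun z hz =>
    (hS.eventually_mem hz).mono fun w hw => h1 w hw
  have ev2 : ∀ z ∈ S, dZetaBar (dZetaBar f) =ᶠ[𝓝 z] fun _ => 0 := fun z hz =>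
    (hS.eventually_mem hz).mono fun w hw => h2 w hw
  obtain ⟨c, hcc⟩ : ∃ c, ∀ z ∈ S, dZetaBar (dZeta f) z = c := by
    refine exists_const_of_wirtinger_eq_zero hS hc fun z hz => ?_
    refine ((hf z hz).dZeta.dZetaBar.hasWirtingerAt).congr_deriv ?_ ?_
    · rw [dZeta_dZetaBar_comm (hf z hz).dZeta, (ev1 z hz).dZetaBar_eq]
      exact (HasWirtingerAt.const 0 z).dZetaBar
    · rw [← (comm z hz).dZetaBar_eq, ← dZeta_dZetaBar_comm (hf z hz).dZetaBar,
        (ev2 z hz).dZeta_eq]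
      exact (HasWirtingerAt.const 0 z).dZeta
  obtain ⟨b, hb⟩ : ∃ b, ∀ z ∈ S, dZeta f z - c * conj z = b := by
    refine exists_const_of_wirtinger_eq_zero hS hc fun z hz => ?_
    refine ((hf z hz).dZeta.hasWirtingerAt.sub ((hasWirtingerAt_conj z).const_mul c)).congr_deriv
      ?_ ?_
    · rw [h1 z hz]; ring
    · rw [hcc z hz]; ring
  obtain ⟨b', hb'⟩ : ∃ b', ∀ z ∈ S, dZetaBar f z - c * z = b' := by
    refine exists_const_of_wirtinger_eq_zero hS hc fun z hz => ?_
    refine ((hf z hz).dZetaBar.hasWirtingerAt.sub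
      ((HasWirtingerAt.ident z).const_mul c)).congr_deriv ?_ ?_
    · rw [dZeta_dZetaBar_comm (hf z hz), hcc z hz]; ring
    · rw [h2 z hz]; ring
  obtain ⟨a, ha⟩ : ∃ a, ∀ z ∈ S, f z - (b * z + b' * conj z + c * (z * conj z)) = a := by
    refine exists_const_of_wirtinger_eq_zero hS hc fun z hz => ?_
    refine ((hf z hz).hasWirtingerAt.sub (((((HasWirtingerAt.ident z).const_mul b).add
      ((hasWirtingerAt_conj z).const_mul b'))).add
      (((HasWirtingerAt.ident z).mul (hasWirtingerAt_conj z)).const_mul c))).congr_deriv ?_ ?_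
    · linear_combination hb z hz
    · linear_combination hb' z hz
  exact ⟨a, b, b', c, fun z hz => by linear_combination ha z hz⟩

/-- Poincaré lemma: a closed form `p dζ + q dζ̄` on the plane is exact. -/
lemma exists_dZeta_eq_dZetaBar_eq {p q : ℂ → ℂ} (hp : ContDiff ℝ ∞ p) (hq : ContDiff ℝ ∞ q)
    (hpq : ∀ z, dZetaBar p z = dZeta q z) :
    ∃ f : ℂ → ℂ, ContDiff ℝ ∞ f ∧ (∀ z, dZeta f z = p z) ∧ ∀ z, dZetaBar f z = q z := by
  have hω : ContDiff ℝ ∞ fun z => wirtingerMap (p z) (q z) :=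
    (hp.smul contDiff_const).add (hq.smul contDiff_const)
  obtain ⟨f, hf⟩ := convex_univ.exists_forall_hasFDerivAt_of_fderiv_symmetric isOpen_univ
    (hω.differentiable (by simp)).differentiableOn
    (fun z _ x y => by
      have e : HasFDerivAt (fun z => wirtingerMap (p z) (q z)) _ z :=
        ((hp.hasWirtingerAt z : HasFDerivAt _ _ _).smul_const (ContinuousLinearMap.id ℝ ℂ)).add
          ((hq.hasWirtingerAt z : HasFDerivAt _ _ _).smul_const (conjCLE : ℂ →L[ℝ] ℂ))
      rw [e.fderiv]
      simp [hpq z]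
      ring)
  have hf' (z : ℂ) : HasWirtingerAt f (p z) (q z) z := hf z trivial
  refine ⟨f, ?_, fun z => (hf' z).dZeta, fun z => (hf' z).dZetaBar⟩
  rw [contDiff_infty_iff_fderiv]
  refine ⟨fun z => (hf' z).differentiableAt, ?_⟩
  convert hω using 1
  ext1 z
  exact HasFDerivAt.fderiv (hf' z)

/-- Poincaré lemma for a real form `p dζ + p̄ dζ̄`: the potential can be taken real. -/
lemma exists_real_dZeta_eq {p : ℂ → ℂ} (hp : ContDiff ℝ ∞ p)
    (hr : ∀ z, conj (dZetaBar p z) = dZetaBar p z) :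
    ∃ f : ℂ → ℝ, ContDiff ℝ ∞ (fun z => (f z : ℂ)) ∧ ∀ z, dZeta (fun z => (f z : ℂ)) z = p z := by
  obtain ⟨f, hf, h1, h2⟩ := exists_dZeta_eq_dZetaBar_eq hp (conjCLE.contDiff.comp hp)
    (fun z => by
      have := dZeta_conj p z
      simp only [Function.comp_def, conjCLE_apply]
      rw [this, hr])
  have e : (fun z => ((f z).re : ℂ)) = fun z => (1 / 2 : ℂ) * (f z + conj (f z)) := by
    ext1 z; rw [re_eq_add_conj]; ring
  refine ⟨fun z => (f z).re, ?_, fun z => ?_⟩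
  · exact ofRealCLM.contDiff.comp (reCLM.contDiff.comp hf)
  · rw [e, (((hf.hasWirtingerAt z).add (hf.hasWirtingerAt z).star).const_mul (1 / 2)).dZeta, h1, h2]
    simp
    ring

/-! ### Spin-weighted functions and `ð` -/

lemma sphereP_eq_ofReal (z : ℂ) : sphereP z = ((1 + ‖z‖ ^ 2 : ℝ) : ℂ) := by
  rw [sphereP, mul_conj, normSq_eq_norm_sq]; push_cast; ring

lemma sphereP_ne_zero (z : ℂ) : sphereP z ≠ 0 := by
  rw [sphereP_eq_ofReal]; exact_mod_cast (by positivity : (1 + ‖z‖ ^ 2 : ℝ) ≠ 0)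

lemma conj_sphereP (z : ℂ) : conj (sphereP z) = sphereP z := by
  rw [sphereP_eq_ofReal, conj_ofReal]

lemma norm_sphereP (z : ℂ) : ‖sphereP z‖ = 1 + ‖z‖ ^ 2 := by
  rw [sphereP_eq_ofReal, norm_real, Real.norm_of_nonneg (by positivity)]

lemma hasWirtingerAt_sphereP (z : ℂ) : HasWirtingerAt sphereP (conj z) z z :=
  ((HasWirtingerAt.const 1 z).add ((HasWirtingerAt.ident z).mul
    (hasWirtingerAt_conj z))).congr_deriv (by ring) (by ring)

lemma contDiff_conj : ContDiff ℝ ∞ (fun z : ℂ => conj z) := conjCLE.contDiff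

lemma ContDiff.star {f : ℂ → ℂ} (h : ContDiff ℝ ∞ f) : ContDiff ℝ ∞ (fun z => conj (f z)) :=
  contDiff_conj.comp h

lemma contDiff_sphereP : ContDiff ℝ ∞ sphereP :=
  contDiff_const.add (contDiff_id.mul contDiff_conj)

lemma sphereP_neg_one_div {z : ℂ} (hz : z ≠ 0) :
    sphereP (-1 / z) = sphereP z / (z * conj z) := by
  have hz' : conj z ≠ 0 := (map_ne_zero _).2 hz
  simp only [sphereP, map_div₀, map_neg, map_one]
  field_simp
  ring

/-- For differentiable functions, `ð η = P ∂η + s ζ̄ η`. -/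
lemma HasWirtingerAt.eth {η : ℂ → ℂ} {p q z : ℂ} (h : HasWirtingerAt η p q z) (s : ℤ) :
    eth s η z = sphereP z * p + s * conj z * η z := by
  have h0 := sphereP_ne_zero z
  rw [_root_.eth, (((hasWirtingerAt_sphereP z).zpow h0 s).mul h).dZeta, zpow_sub₀ h0,
    zpow_sub_one₀ h0, zpow_one]
  field_simp
  ring

lemma ContDiff.eth_apply {η : ℂ → ℂ} (h : ContDiff ℝ ∞ η) (s : ℤ) (z : ℂ) :
    _root_.eth s η z = sphereP z * _root_.dZeta η z + s * conj z * η z :=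
  (h.hasWirtingerAt z).eth s

lemma conj_eth (s : ℤ) (η : ℂ → ℂ) (z : ℂ) :
    conj (eth s η z) = ethBar (-s) (fun w => conj (η w)) z := by
  rw [eth, ethBar, map_mul, map_zpow₀, conj_sphereP, ← dZetaBar_conj]
  simp only [map_mul, map_zpow₀, conj_sphereP, neg_neg, ← sub_eq_add_neg]

/-- For differentiable functions, `ð̄ η = P ∂̄η - s ζ η`. -/
lemma HasWirtingerAt.ethBar {η : ℂ → ℂ} {p q z : ℂ} (h : HasWirtingerAt η p q z) (s : ℤ) :
    ethBar s η z = sphereP z * q - s * z * η z := by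
  have := conj_eth (-s) (fun w => conj (η w)) z
  simp only [conj_conj, neg_neg] at this
  rw [← this, h.star.eth]
  simp [conj_sphereP, sub_eq_add_neg]

lemma ContDiff.eth {η : ℂ → ℂ} (h : ContDiff ℝ ∞ η) (s : ℤ) : ContDiff ℝ ∞ (eth s η) := by
  have : _root_.eth s η = fun z => sphereP z * _root_.dZeta η z + s * conj z * η z :=
    funext fun z => h.eth_apply s z
  rw [this]
  exact (contDiff_sphereP.mul h.dZeta).add ((contDiff_const.mul contDiff_conj).mul h)

lemma ContDiff.ethBar {η : ℂ → ℂ} (h : ContDiff ℝ ∞ η) (s : ℤ) : ContDiff ℝ ∞ (ethBar s η) := by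
  have : _root_.ethBar s η = fun z => sphereP z * _root_.dZetaBar η z - s * z * η z :=
    funext fun z => (h.hasWirtingerAt z).ethBar s
  rw [this]
  exact (contDiff_sphereP.mul h.dZetaBar).sub ((contDiff_const.mul contDiff_id).mul h)

/-- `ð` commutes with the passage to the coordinate `-1/ζ`. -/
lemma eth_neg_one_div {s : ℤ} {η η' : ℂ → ℂ}
    (h : ∀ z : ℂ, z ≠ 0 → η' (-1 / z) = (z / conj z) ^ s * η z) {z : ℂ} (hz : z ≠ 0)
    (hd : DifferentiableAt ℝ η z) :
    eth s η' (-1 / z) = (z / conj z) ^ (s + 1) * eth s η z := by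
  have hz' : conj z ≠ 0 := (map_ne_zero _).2 hz
  have hw : -1 / z ≠ 0 := div_ne_zero (by simp) hz
  have hi : -1 / (-1 / z) = z := by field_simp
  -- the relation, solved for `η'` near `w = -1/z`
  have e : η' =ᶠ[𝓝 (-1 / z)] fun w => (conj w / w) ^ s * η (-1 / w) := by
    filter_upwards [isOpen_ne.mem_nhds hw] with w hw0
    have hw0' : conj w ≠ 0 := (map_ne_zero _).2 hw0
    have := h (-1 / w) (div_ne_zero (by simp) hw0)
    rw [show -1 / (-1 / w) = w by field_simp] at this
    rw [this]
    congr 2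
    simp only [map_div₀, map_neg, map_one]
    field_simp
  have hφ : HasDerivAt (fun w : ℂ => -1 / w) (z ^ 2) (-1 / z) := by
    have := (hasDerivAt_inv hw).const_mul (-1 : ℂ)
    refine (this.congr_deriv ?_).congr_of_eventuallyEq ?_
    · field_simp
    · exact Eventually.of_forall fun w => by simp [div_eq_mul_inv]
  have hη : HasWirtingerAt η (dZeta η z) (dZetaBar η z) (-1 / (-1 / z)) := by
    rw [hi]; exact hd.hasWirtingerAt
  have hq : HasWirtingerAt (fun w => conj w / w) _ _ (-1 / z) :=
    (hasWirtingerAt_conj _).div (HasWirtingerAt.ident _) hw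
  have h0 : conj (-1 / z) / (-1 / z) = z / conj z := by
    simp only [map_div₀, map_neg, map_one]; field_simp
  have key := ((hq.zpow (by rw [h0]; exact div_ne_zero hz hz') s).mul
    (hη.comp_holomorphic hφ)).congr_of_eventuallyEq e
  rw [key.eth, hd.hasWirtingerAt.eth, sphereP_neg_one_div hz]
  simp only [h (z) hz, h0, hi]
  have hne : z / conj z ≠ 0 := div_ne_zero hz hz'
  rw [zpow_sub_one₀ hne, zpow_add_one₀ hne]
  simp only [map_div₀, map_neg, map_one]
  field_simp
  simp only [sphereP]
  ring

lemma conj_div_conj_zpow (z : ℂ) (s : ℤ) : conj ((z / conj z) ^ s) = (z / conj z) ^ (-s) := by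
  rw [map_zpow₀, map_div₀, conj_conj, zpow_neg, ← inv_zpow, inv_div]

namespace SmoothSpin

variable {s t : ℤ} {η ρ : ℂ → ℂ}

lemma contDiff (h : SmoothSpin s η) : ContDiff ℝ ∞ η := h.1

lemma eth (h : SmoothSpin s η) : SmoothSpin (s + 1) (eth s η) := by
  obtain ⟨h1, η', h2, h3⟩ := h
  exact ⟨h1.eth s, _, h2.eth s, fun z hz =>
    eth_neg_one_div h3 hz (h1.differentiable (by simp) z)⟩

protected lemma star (h : SmoothSpin s η) : SmoothSpin (-s) (fun z => conj (η z)) := by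
  obtain ⟨h1, η', h2, h3⟩ := h
  refine ⟨h1.star, _, h2.star, fun z hz => ?_⟩
  rw [h3 z hz, map_mul, conj_div_conj_zpow]

lemma ethBar (h : SmoothSpin s η) : SmoothSpin (s - 1) (ethBar s η) := by
  have := h.star.eth.star
  simp only [conj_eth, neg_neg, conj_conj] at this
  convert this using 1
  ring

lemma add (h : SmoothSpin s η) (k : SmoothSpin s ρ) : SmoothSpin s (fun z => η z + ρ z) := by
  obtain ⟨h1, η', h2, h3⟩ := h
  obtain ⟨k1, ρ', k2, k3⟩ := k
  exact ⟨h1.add k1, _, h2.add k2, fun z hz => by rw [h3 z hz, k3 z hz, mul_add]⟩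

lemma mul (h : SmoothSpin s η) (k : SmoothSpin t ρ) :
    SmoothSpin (s + t) (fun z => η z * ρ z) := by
  obtain ⟨h1, η', h2, h3⟩ := h
  obtain ⟨k1, ρ', k2, k3⟩ := k
  refine ⟨h1.mul k1, _, h2.mul k2, fun z hz => ?_⟩
  rw [h3 z hz, k3 z hz, zpow_add₀ (div_ne_zero hz ((map_ne_zero _).2 hz))]
  ring

lemma const (c : ℂ) : SmoothSpin 0 (fun _ => c) :=
  ⟨contDiff_const, _, contDiff_const, fun z _ => by rw [zpow_zero, one_mul]⟩

lemma const_mul (c : ℂ) (h : SmoothSpin s η) : SmoothSpin s (fun z => c * η z) := by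
  simpa using (const c).mul h

lemma zero (s : ℤ) : SmoothSpin s (fun _ => 0) :=
  ⟨contDiff_const, _, contDiff_const, fun z _ => by rw [mul_zero]⟩

lemma sub (h : SmoothSpin s η) (k : SmoothSpin s ρ) : SmoothSpin s (fun z => η z - ρ z) := by
  simpa [sub_eq_add_neg] using h.add (k.const_mul (-1))

lemma sum {ι : Type*} (S : Finset ι) {f : ι → ℂ → ℂ} (h : ∀ i ∈ S, SmoothSpin s (f i)) :
    SmoothSpin s (fun z => ∑ i ∈ S, f i z) := by
  classical
  induction S using Finset.induction_on with
  | empty => simpa using zero s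
  | insert i S hi ih =>
    simp only [Finset.sum_insert hi]
    exact (h i (by simp)).add (ih fun j hj => h j (by simp [hj]))

/-- Smooth spin-weighted functions on the compact sphere are bounded. -/
lemma exists_norm_le (h : SmoothSpin s η) : ∃ C, ∀ z, ‖η z‖ ≤ C := by
  obtain ⟨h1, η', h2, h3⟩ := h
  obtain ⟨C, hC⟩ := (isCompact_closedBall (0 : ℂ) 1).exists_bound_of_continuousOn
    h1.continuous.continuousOn
  obtain ⟨C', hC'⟩ := (isCompact_closedBall (0 : ℂ) 1).exists_bound_of_continuousOn
    h2.continuous.continuousOn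
  refine ⟨max C C', fun z => ?_⟩
  rcases le_total ‖z‖ 1 with hz | hz
  · exact (hC z (by simpa using hz)).trans (le_max_left _ _)
  · have hz0 : z ≠ 0 := by rintro rfl; norm_num at hz
    have := hC' (-1 / z) (by simpa using inv_le_one_of_one_le₀ hz)
    rw [h3 z hz0, norm_mul, norm_zpow, norm_div, RCLike.norm_conj,
      div_self (norm_ne_zero_iff.2 hz0), one_zpow, one_mul] at this
    exact this.trans (le_max_right _ _)

end SmoothSpin

lemma smoothSpin_of_field {s : ℤ} {η : ℝ → ℂ → ℂ} (h : SmoothSpinField s η) (u : ℝ) :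
    SmoothSpin s (η u) := by
  obtain ⟨h1, η', h2, h3⟩ := h
  exact ⟨h1.comp (contDiff_const.prodMk contDiff_id), η' u,
    h2.comp (contDiff_const.prodMk contDiff_id), h3 u⟩

lemma SmoothSpin.field {s : ℤ} {η : ℂ → ℂ} (h : SmoothSpin s η) :
    SmoothSpinField s (fun _ => η) := by
  obtain ⟨h1, η', h2, h3⟩ := h
  exact ⟨h1.comp contDiff_snd, fun _ => η', h2.comp contDiff_snd, fun _ => h3⟩

section linearity

variable {s : ℤ} {η ρ : ℂ → ℂ}

lemma eth_add (h : ContDiff ℝ ∞ η) (k : ContDiff ℝ ∞ ρ) (z : ℂ) :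
    eth s (fun w => η w + ρ w) z = eth s η z + eth s ρ z := by
  rw [((h.hasWirtingerAt z).add (k.hasWirtingerAt z)).eth, h.eth_apply, k.eth_apply]; ring

lemma eth_const_mul (c : ℂ) (h : ContDiff ℝ ∞ η) (z : ℂ) :
    eth s (fun w => c * η w) z = c * eth s η z := by
  rw [((h.hasWirtingerAt z).const_mul c).eth, h.eth_apply]; ring

lemma eth_sub (h : ContDiff ℝ ∞ η) (k : ContDiff ℝ ∞ ρ) (z : ℂ) :
    eth s (fun w => η w - ρ w) z = eth s η z - eth s ρ z := by
  rw [((h.hasWirtingerAt z).sub (k.hasWirtingerAt z)).eth, h.eth_apply, k.eth_apply]; ring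

@[simp] lemma eth_zero_fun (z : ℂ) : eth s (fun _ => 0) z = 0 := by
  rw [(HasWirtingerAt.const 0 z).eth]; ring

lemma eth_zero_const (c z : ℂ) : eth 0 (fun _ => c) z = 0 := by
  rw [(HasWirtingerAt.const c z).eth]; simp

end linearity

/-- In terms of `f = P g`, the good cut operator is `ð²g = P ∂²f`. -/
lemma eth_eth_eq {S : Set ℂ} (hS : IsOpen S) {g : ℂ → ℂ} (hg : ∀ z ∈ S, ContDiffAt ℝ ∞ g z)
    {z : ℂ} (hz : z ∈ S) :
    eth 1 (eth 0 g) z = sphereP z * dZeta (dZeta fun w => sphereP w * g w) z := by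
  have e1 : eth 0 g = fun w => sphereP w * dZeta g w := by
    ext1 w; simp [eth]
  have e2 : dZeta (fun w => sphereP w * g w)
      =ᶠ[𝓝 z] fun w => conj w * g w + sphereP w * dZeta g w :=
    (hS.eventually_mem hz).mono fun w hw =>
      ((hasWirtingerAt_sphereP w).mul (hg w hw).hasWirtingerAt).dZeta
  have h1 := (hasWirtingerAt_sphereP z).mul (hg z hz).dZeta.hasWirtingerAt
  rw [e1, e2.dZeta_eq, h1.eth,
    (((hasWirtingerAt_conj z).mul (hg z hz).hasWirtingerAt).add h1).dZeta]
  push_cast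
  ring

/-- In terms of `q = P⁻¹ σ`, one has `ð̄²σ = P³ ∂̄²q` for `σ` of spin weight two. -/
lemma ethBar_ethBar_eq {q : ℂ → ℂ} (hq : ContDiff ℝ ∞ q) (z : ℂ) :
    ethBar 1 (ethBar 2 fun w => sphereP w * q w) z
      = sphereP z ^ 3 * dZetaBar (dZetaBar q) z := by
  have e1 : ethBar 2 (fun w => sphereP w * q w)
      = fun w => sphereP w * (sphereP w * dZetaBar q w - w * q w) := by
    ext1 w
    rw [((hasWirtingerAt_sphereP w).mul (hq.hasWirtingerAt w)).ethBar]
    push_cast; ring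
  rw [e1, ((hasWirtingerAt_sphereP z).mul
    (((hasWirtingerAt_sphereP z).mul (hq.dZetaBar.hasWirtingerAt z)).sub
      ((HasWirtingerAt.ident z).mul (hq.hasWirtingerAt z)))).ethBar]
  push_cast
  ring

/-! ### Integration over the sphere -/

lemma exists_isometry_eq_I_mul : ∃ e : ℂ ≃ₗᵢ[ℝ] ℂ, ∀ z, e z = I * z :=
  ⟨rotation ⟨I, by simp [Submonoid.unitSphere]⟩, fun z => rotation_apply _ z⟩

lemma integral_I_mul (f : ℂ → ℂ) : ∫ z, f (I * z) = ∫ z, f z := by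
  obtain ⟨e, he⟩ := exists_isometry_eq_I_mul
  have := e.measurePreserving.integral_comp e.toHomeomorph.measurableEmbedding f
  simpa only [he] using this

lemma integrable_sphere_weight :
    Integrable (fun z : ℂ => ((1 : ℝ) + ‖z‖ ^ 2) ^ (-(3 : ℝ) / 2)) :=
  integrable_rpow_neg_one_add_norm_sq (by rw [finrank_real_complex]; norm_num)

/-- A continuous function that is `O(|ζ|)` is integrable against the area element. -/
lemma integrable_div_sphereP_sq {f : ℂ → ℂ} (hf : Continuous f) {C : ℝ}
    (hC : ∀ z, ‖f z‖ ≤ C * (1 + ‖z‖ ^ 2) ^ ((1 : ℝ) / 2)) :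
    Integrable fun z => f z / sphereP z ^ 2 := by
  refine (integrable_sphere_weight.const_mul C).mono' ?_ (Eventually.of_forall fun z => ?_)
  · exact (hf.div (contDiff_sphereP.continuous.pow 2)
      fun z => pow_ne_zero 2 (sphereP_ne_zero z)).aestronglyMeasurable
  · have h0 : 0 < 1 + ‖z‖ ^ 2 := by positivity
    rw [norm_div, norm_pow, norm_sphereP, div_le_iff₀ (by positivity), mul_assoc,
      ← Real.rpow_natCast (1 + ‖z‖ ^ 2) 2, ← Real.rpow_add h0]
    rw [show (-3 / 2 : ℝ) + ((2 : ℕ) : ℝ) = 1 / 2 by norm_num]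
    exact hC z

lemma one_le_sphere_sqrt (z : ℂ) : 1 ≤ (1 + ‖z‖ ^ 2) ^ ((1 : ℝ) / 2) :=
  Real.one_le_rpow (by nlinarith [norm_nonneg z]) (by norm_num)

lemma norm_le_sphere_sqrt (z : ℂ) : ‖z‖ ≤ (1 + ‖z‖ ^ 2) ^ ((1 : ℝ) / 2) := by
  rw [← Real.sqrt_eq_rpow]
  exact Real.le_sqrt_of_sq_le (by linarith)

lemma integrable_div_sphereP_sq_of_bounded {f : ℂ → ℂ} (hf : Continuous f) {C : ℝ}
    (hC : ∀ z, ‖f z‖ ≤ C) : Integrable fun z => f z / sphereP z ^ 2 :=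
  integrable_div_sphereP_sq hf (C := C) fun z => (hC z).trans
    (le_mul_of_one_le_right ((norm_nonneg _).trans (hC 0)) (one_le_sphere_sqrt z))

lemma integral_fderiv_one_eq_zero {h : ℂ → ℂ} (hd : Differentiable ℝ h)
    (h0 : Tendsto h (cocompact ℂ) (𝓝 0)) (hi : Integrable fun z => fderiv ℝ h z 1) :
    ∫ z, fderiv ℝ h z 1 = 0 := by
  have mp := volume_preserving_equiv_real_prod.symm
  rw [← mp.integral_comp measurableEquivRealProd.symm.measurableEmbedding]
  have hi' : Integrable (fun p : ℝ × ℝ => fderiv ℝ h (measurableEquivRealProd.symm p) 1)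
      (volume.prod volume) :=
    (mp.integrable_comp_emb measurableEquivRealProd.symm.measurableEmbedding).2 hi
  rw [Measure.volume_eq_prod, integral_prod_symm _ hi']
  refine integral_eq_zero_of_ae ?_
  filter_upwards [hi'.prod_left_ae] with y hy
  have hline (x : ℝ) : HasDerivAt (fun t : ℝ => h (measurableEquivRealProd.symm (t, y)))
      (fderiv ℝ h (measurableEquivRealProd.symm (x, y)) 1) x := by
    have e : HasDerivAt (fun t : ℝ => measurableEquivRealProd.symm (t, y)) 1 x := by
      have : (fun t : ℝ => measurableEquivRealProd.symm (t, y)) = fun t : ℝ => (t : ℂ) + y * I := by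
        ext1 t
        rw [measurableEquivRealProd_symm_apply, Complex.mk_eq_add_mul_I]
      rw [this]
      exact (ofRealCLM.hasDerivAt (x := x)).add_const _
    exact (hd _).hasFDerivAt.comp_hasDerivAt x e
  have hlim : Tendsto (fun t : ℝ => measurableEquivRealProd.symm (t, y)) (cocompact ℝ)
      (cocompact ℂ) := by
    rw [← Metric.cobounded_eq_cocompact (α := ℂ), ← tendsto_norm_atTop_iff_cobounded]
    refine tendsto_atTop_mono (fun t => ?_) (tendsto_norm_cocompact_atTop (E := ℝ))
    simpa using abs_re_le_norm (measurableEquivRealProd.symm (t, y))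
  have := integral_of_hasDerivAt_of_tendsto hline hy
    (h0.comp (hlim.mono_left atBot_le_cocompact)) (h0.comp (hlim.mono_left atTop_le_cocompact))
  simpa using this

/-- Stokes' theorem on the plane for functions that vanish at infinity. -/
lemma integral_dZeta_eq_zero {h : ℂ → ℂ} (hd : Differentiable ℝ h)
    (h0 : Tendsto h (cocompact ℂ) (𝓝 0)) (hi : Integrable (dZeta h))
    (hi' : Integrable (dZetaBar h)) : ∫ z, dZeta h z = 0 := by
  have e (v z : ℂ) : fderiv ℝ h z v = v * dZeta h z + conj v * dZetaBar h z := by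
    rw [HasFDerivAt.fderiv (hd z).hasWirtingerAt, wirtingerMap_apply]; ring
  have hv (v : ℂ) : Integrable fun z => fderiv ℝ h z v := by
    simp only [e]; exact (hi.const_mul _).add (hi'.const_mul _)
  have hx := integral_fderiv_one_eq_zero hd h0 (hv 1)
  have hy : ∫ z, fderiv ℝ h z I = 0 := by
    have hI (z : ℂ) : HasDerivAt (fun w : ℂ => I * w) I z := by
      simpa using (hasDerivAt_id z).const_mul I
    have eI (z : ℂ) : fderiv ℝ (fun w => h (I * w)) z 1 = fderiv ℝ h (I * z) I := by
      have := (hd (I * z)).hasWirtingerAt.comp_holomorphic (hI z)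
      rw [HasFDerivAt.fderiv this, e]
      simp
      ring
    have hdI : Differentiable ℝ fun w => h (I * w) :=
      hd.comp (differentiable_id.const_mul I)
    have h0I : Tendsto (fun w => h (I * w)) (cocompact ℂ) (𝓝 0) :=
      h0.comp (Homeomorph.mulLeft₀ I I_ne_zero).isClosedEmbedding.tendsto_cocompact
    have := integral_fderiv_one_eq_zero hdI h0I (by
      simp only [eI]
      obtain ⟨e, he⟩ := exists_isometry_eq_I_mul
      have := (e.measurePreserving.integrable_comp_emb e.toHomeomorph.measurableEmbedding).2 (hv I)
      simpa only [Function.comp_def, he] using this)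
    simp only [eI] at this
    rwa [integral_I_mul (fun z => fderiv ℝ h z I)] at this
  simp only [dZeta]
  rw [integral_const_mul, integral_sub (hv 1) ((hv I).const_mul I), integral_const_mul, hx, hy]
  ring

/-- The sphere average of `ð f` vanishes for `f` of spin weight `-1`. -/
lemma sphereAvg_eth_neg_one {f : ℂ → ℂ} (hf : SmoothSpin (-1) f) :
    sphereAvg (eth (-1) f) = 0 := by
  obtain ⟨C, hC⟩ := hf.exists_norm_le
  obtain ⟨C1, hC1⟩ := hf.eth.exists_norm_le
  obtain ⟨C2, hC2⟩ := hf.ethBar.exists_norm_le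
  have hP := sphereP_ne_zero
  set h : ℂ → ℂ := fun z => sphereP z ^ (-1 : ℤ) * f z with hh
  have hW (z : ℂ) := ((hasWirtingerAt_sphereP z).zpow (hP z) (-1)).mul
    (hf.contDiff.hasWirtingerAt z)
  have e1 (z : ℂ) : eth (-1) f z / sphereP z ^ 2 = dZeta h z := by
    rw [eth, show (1 - (-1) : ℤ) = (2 : ℕ) by norm_num, zpow_natCast]
    change _ = dZeta (fun z => sphereP z ^ (-1 : ℤ) * f z) z
    have := hP z
    rw [mul_comm, mul_div_assoc, div_self (pow_ne_zero 2 this), mul_one]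
  have e2 (z : ℂ) : dZetaBar h z = (ethBar (-1) f z - 2 * z * f z) / sphereP z ^ 2 := by
    rw [(hW z).dZetaBar, (hf.contDiff.hasWirtingerAt z).ethBar]
    have : sphereP z ^ (-1 - 1 : ℤ) = (sphereP z ^ 2)⁻¹ := by
      rw [show (-1 - 1 : ℤ) = -(2 : ℕ) by norm_num, zpow_neg, zpow_natCast]
    rw [this, zpow_neg_one]
    have := hP z
    field_simp
    push_cast
    ring
  have i1 : Integrable (dZeta h) := by
    have := integrable_div_sphereP_sq_of_bounded hf.eth.contDiff.continuous hC1
    simpa only [e1] using this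
  have i2 : Integrable (dZetaBar h) := by
    have hc : Continuous fun z => ethBar (-1) f z - 2 * z * f z :=
      hf.ethBar.contDiff.continuous.sub
        ((continuous_const.mul continuous_id).mul hf.contDiff.continuous)
    have hb (z : ℂ) : ‖ethBar (-1) f z - 2 * z * f z‖
        ≤ (C2 + 2 * C) * (1 + ‖z‖ ^ 2) ^ ((1 : ℝ) / 2) := by
      have hC0 : 0 ≤ C := (norm_nonneg _).trans (hC 0)
      have hC20 : 0 ≤ C2 := (norm_nonneg _).trans (hC2 0)
      calc ‖ethBar (-1) f z - 2 * z * f z‖ ≤ C2 + 2 * ‖z‖ * C := by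
            refine (norm_sub_le _ _).trans (add_le_add (hC2 z) ?_)
            rw [norm_mul, norm_mul, Complex.norm_ofNat]
            exact mul_le_mul_of_nonneg_left (hC z) (by positivity)
        _ ≤ _ := by
            rw [add_mul]
            refine add_le_add (le_mul_of_one_le_right hC20 (one_le_sphere_sqrt z)) ?_
            nlinarith [mul_le_mul_of_nonneg_left (norm_le_sphere_sqrt z) hC0]
    refine (integrable_div_sphereP_sq hc hb).congr (Eventually.of_forall fun z => ?_)
    exact (e2 z).symm
  have h0 : Tendsto h (cocompact ℂ) (𝓝 0) := by
    rw [tendsto_zero_iff_norm_tendsto_zero]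
    have hl : Tendsto (fun z : ℂ => C * (1 + ‖z‖ ^ 2)⁻¹) (cocompact ℂ) (𝓝 (C * 0)) :=
      (tendsto_inv_atTop_zero.comp (tendsto_atTop_add_const_left _ 1
        ((tendsto_pow_atTop two_ne_zero).comp tendsto_norm_cocompact_atTop))).const_mul C
    rw [mul_zero] at hl
    refine squeeze_zero (fun _ => norm_nonneg _) (fun z => ?_) hl
    rw [hh, norm_mul, norm_zpow, norm_sphereP, zpow_neg_one, mul_comm]
    exact mul_le_mul_of_nonneg_right (hC z) (by positivity)
  rw [sphereAvg]
  simp only [e1]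
  rw [integral_dZeta_eq_zero (fun z => (hW z).differentiableAt) h0 i1 i2, mul_zero]

/-- The radial integrals `∫ P^{-(n+2)} d²ζ = π/(n+1)`. -/
lemma integral_inv_sphereP_pow (n : ℕ) :
    ∫ z : ℂ, (sphereP z ^ (n + 2))⁻¹ = (Real.pi / (n + 1) : ℂ) := by
  have hn : (0 : ℝ) < n + 1 := by positivity
  have key : ∫ y in Set.Ioi (0 : ℝ), y * ((1 + y ^ 2) ^ (n + 2))⁻¹ = 1 / (2 * (n + 1)) := by
    have hd (y : ℝ) : HasDerivAt (fun y : ℝ => -(1 / (2 * ((n : ℝ) + 1))) * ((1 + y ^ 2) ^ (n + 1))⁻¹)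
        (y * ((1 + y ^ 2) ^ (n + 2))⁻¹) y := by
      have h1 : (1 + y ^ 2) ^ (n + 1) ≠ 0 := by positivity
      have h2 : HasDerivAt (fun y : ℝ => 1 + y ^ 2) (2 * y) y := by
        simpa using (hasDerivAt_pow 2 y).const_add 1
      refine (((h2.pow (n + 1)).inv h1).const_mul _).congr_deriv ?_
      have h3 : (1 + y ^ 2) ≠ 0 := by positivity
      push_cast
      simp only [Pi.pow_apply]
      field_simp
      ring
    have hl : Tendsto (fun y : ℝ => -(1 / (2 * ((n : ℝ) + 1))) * ((1 + y ^ 2) ^ (n + 1))⁻¹) atTop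
        (𝓝 (-(1 / (2 * ((n : ℝ) + 1))) * 0)) :=
      (tendsto_inv_atTop_zero.comp ((tendsto_pow_atTop (Nat.succ_ne_zero n)).comp
        (tendsto_atTop_add_const_left _ 1 (tendsto_pow_atTop two_ne_zero)))).const_mul _
    rw [integral_Ioi_of_hasDerivAt_of_nonneg' (fun y _ => hd y)
      (fun y hy => by have : 0 < y := hy; positivity) hl]
    simp
  have h := integral_fun_norm_addHaar (volume : Measure ℂ) (fun y => ((1 + y ^ 2) ^ (n + 2))⁻¹)
  rw [finrank_real_complex] at h
  simp only [Nat.add_one_sub_one, pow_one, smul_eq_mul, nsmul_eq_mul] at h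
  rw [key] at h
  have hv : (volume : Measure ℂ).real (Metric.ball 0 1) = Real.pi := by
    simp [Measure.real, Complex.volume_ball]
  rw [hv] at h
  have e : (fun z : ℂ => (sphereP z ^ (n + 2))⁻¹)
      = fun z : ℂ => ((((1 + ‖z‖ ^ 2) ^ (n + 2))⁻¹ : ℝ) : ℂ) := by
    ext1 z; rw [sphereP_eq_ofReal]; push_cast; rfl
  rw [e, integral_complex_ofReal, h]
  push_cast
  field_simp

lemma sphereAvg_const (c : ℂ) : sphereAvg (fun _ => c) = c := by
  have := integral_inv_sphereP_pow 0
  simp only [zero_add] at this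
  rw [sphereAvg]
  simp only [div_eq_mul_inv]
  rw [integral_const_mul, this]
  have : (Real.pi : ℂ) ≠ 0 := by exact_mod_cast Real.pi_ne_zero
  simp
  field_simp

lemma sphereAvg_add {f g : ℂ → ℂ} {s t : ℤ} (hf : SmoothSpin s f) (hg : SmoothSpin t g) :
    sphereAvg (fun z => f z + g z) = sphereAvg f + sphereAvg g := by
  obtain ⟨C, hC⟩ := hf.exists_norm_le
  obtain ⟨C', hC'⟩ := hg.exists_norm_le
  simp only [sphereAvg, add_div]
  rw [integral_add (integrable_div_sphereP_sq_of_bounded hf.contDiff.continuous hC)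
    (integrable_div_sphereP_sq_of_bounded hg.contDiff.continuous hC'), mul_add]

/-- The integrand `ζᵃ ζ̄ᵇ P⁻⁴` of the products of two spin-weight-one harmonics. -/
noncomputable def sphereMonomial (a b : Fin 3) (z : ℂ) : ℂ :=
  z ^ (a : ℕ) * conj z ^ (b : ℕ) / sphereP z ^ 4

lemma integrable_sphereMonomial (a b : Fin 3) : Integrable (sphereMonomial a b) := by
  have hc : Continuous fun z : ℂ => z ^ (a : ℕ) * conj z ^ (b : ℕ) / sphereP z ^ 2 :=
    ((continuous_id.pow _).mul (continuous_conj.pow _)).div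
      (contDiff_sphereP.continuous.pow 2) fun z => pow_ne_zero 2 (sphereP_ne_zero z)
  have hb (z : ℂ) : ‖z ^ (a : ℕ) * conj z ^ (b : ℕ) / sphereP z ^ 2‖ ≤ 1 := by
    have hk (k : Fin 3) : ‖z‖ ^ (k : ℕ) ≤ 1 + ‖z‖ ^ 2 := by
      have := norm_nonneg z
      fin_cases k <;> norm_num <;> nlinarith [sq_nonneg (‖z‖ - 1)]
    rw [norm_div, norm_mul, norm_pow, norm_pow, norm_pow, RCLike.norm_conj, norm_sphereP,
      div_le_one (by positivity), sq (1 + _)]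
    exact mul_le_mul (hk a) (hk b) (by positivity) (by positivity)
  refine (integrable_div_sphereP_sq_of_bounded hc hb).congr (Eventually.of_forall fun z => ?_)
  have := sphereP_ne_zero z
  simp only [sphereMonomial]
  field_simp

/-- Monomials of different angular dependence integrate to zero, by the symmetry `ζ ↦ iζ`. -/
lemma integral_sphereMonomial_of_ne {a b : Fin 3} (h : a ≠ b) :
    ∫ z, sphereMonomial a b z = 0 := by
  have e (z : ℂ) : sphereMonomial a b (I * z)
      = (I ^ (a : ℕ) * (-I) ^ (b : ℕ)) * sphereMonomial a b z := by
    have : sphereP (I * z) = sphereP z := by simp [sphereP_eq_ofReal]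
    simp only [sphereMonomial, this, map_mul, conj_I, mul_pow]
    ring
  have h1 := integral_I_mul (sphereMonomial a b)
  simp only [e] at h1
  rw [integral_const_mul] at h1
  have h2 : (I ^ (a : ℕ) * (-I) ^ (b : ℕ) - 1) * ∫ z, sphereMonomial a b z = 0 := by
    rw [sub_mul, h1, one_mul, sub_self]
  refine (mul_eq_zero.1 h2).resolve_left fun h3 => ?_
  fin_cases a <;> fin_cases b <;> simp_all [Complex.ext_iff] <;> norm_num at h3

lemma integral_sphereMonomial_self (a : Fin 3) :
    ∫ z, sphereMonomial a a z = Real.pi * ![1 / 3, 1 / 6, 1 / 3] a := by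
  have i2 := integral_inv_sphereP_pow 0
  have i3 := integral_inv_sphereP_pow 1
  have i4 := integral_inv_sphereP_pow 2
  have n (k : ℕ) : Integrable fun z => (sphereP z ^ (k + 2))⁻¹ := by
    by_contra hk
    have := integral_undef hk
    rw [integral_inv_sphereP_pow] at this
    have hk1 : (k + 1 : ℂ) ≠ 0 := by exact_mod_cast k.succ_ne_zero
    simp [hk1, Real.pi_ne_zero] at this
  have hP := sphereP_ne_zero
  have hz (z : ℂ) : z * conj z = sphereP z - 1 := by rw [sphereP]; ring
  fin_cases a
  · have e : sphereMonomial 0 0 = fun z => (sphereP z ^ (2 + 2))⁻¹ := by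
      ext1 z; simp [sphereMonomial]
    change ∫ z, sphereMonomial 0 0 z = _
    rw [e, i4]; simp; ring
  · have e : sphereMonomial 1 1 = fun z => (sphereP z ^ (1 + 2))⁻¹ - (sphereP z ^ (2 + 2))⁻¹ := by
      ext1 z
      have := hP z
      simp only [sphereMonomial, Fin.val_one, pow_one, hz]
      field_simp
      ring
    change ∫ z, sphereMonomial 1 1 z = _
    rw [e, integral_sub (n 1) (n 2), i3, i4]
    simp; ring
  · have e : sphereMonomial 2 2 = fun z => (sphereP z ^ (0 + 2))⁻¹
        - 2 * (sphereP z ^ (1 + 2))⁻¹ + (sphereP z ^ (2 + 2))⁻¹ := by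
      ext1 z
      have := hP z
      simp only [sphereMonomial, Fin.val_two, ← mul_pow, hz]
      field_simp
      ring
    change ∫ z, sphereMonomial 2 2 z = _
    have h2 := (n 1).const_mul 2
    have h02 : Integrable fun z : ℂ => (sphereP z ^ (0 + 2))⁻¹ - 2 * (sphereP z ^ (1 + 2))⁻¹ :=
      (n 0).sub h2
    rw [e, integral_add h02 (n 2), integral_sub (n 0) h2, integral_const_mul, i2, i3, i4]
    simp; ring

/-- The coefficients of `-√2 P Y¹_{1i}` as a polynomial in `ζ̄`. -/
noncomputable def Y11Coeff (i b : Fin 3) : ℂ := ![![1, 0, -1], ![-I, 0, -I], ![0, 2, 0]] i b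

lemma Y11_eq_sum (i : Fin 3) (z : ℂ) :
    Y11 i z = -1 / ((√2 : ℂ) * sphereP z) * ∑ b : Fin 3, Y11Coeff i b * conj z ^ (b : ℕ) := by
  rw [Y11]
  congr 1
  fin_cases i <;> simp [Y11Coeff, Fin.sum_univ_three] <;> ring

lemma ofReal_sqrt_two_sq : (√2 : ℂ) ^ 2 = 2 := by
  rw [← ofReal_pow, Real.sq_sqrt (by norm_num)]; norm_num

lemma ofReal_sqrt_two_ne_zero : (√2 : ℂ) ≠ 0 := by
  intro h; have := ofReal_sqrt_two_sq; rw [h] at this; norm_num at this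

lemma sphereAvg_Y11_mul_conj (i j : Fin 3) :
    sphereAvg (fun z => Y11 j z * conj (Y11 i z)) = if i = j then 1 / 3 else 0 := by
  have e (z : ℂ) : Y11 j z * conj (Y11 i z) / sphereP z ^ 2
      = ∑ a : Fin 3, ∑ b : Fin 3, (1 / 2 * (Y11Coeff j b * conj (Y11Coeff i a)))
          * sphereMonomial a b z := by
    have hP := sphereP_ne_zero z
    have h2 := ofReal_sqrt_two_ne_zero
    have h3 := ofReal_sqrt_two_sq
    rw [Y11_eq_sum, Y11_eq_sum]
    simp only [map_mul, map_div₀, map_neg, map_one, conj_ofReal, conj_sphereP, map_sum, map_pow,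
      conj_conj, sphereMonomial]
    have : (-1 / ((√2 : ℂ) * sphereP z) * ∑ b : Fin 3, Y11Coeff j b * conj z ^ (b : ℕ))
        * (-1 / ((√2 : ℂ) * sphereP z) * ∑ a : Fin 3, conj (Y11Coeff i a) * z ^ (a : ℕ))
          / sphereP z ^ 2 = 1 / (2 * sphereP z ^ 4) *
        ((∑ a : Fin 3, conj (Y11Coeff i a) * z ^ (a : ℕ))
          * ∑ b : Fin 3, Y11Coeff j b * conj z ^ (b : ℕ)) := by
      rw [← h3]; field_simp
    rw [this, Finset.sum_mul_sum, Finset.mul_sum]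
    refine Finset.sum_congr rfl fun a _ => ?_
    rw [Finset.mul_sum]
    refine Finset.sum_congr rfl fun b _ => ?_
    field_simp
  have hi (a b : Fin 3) : Integrable fun z => (1 / 2 * (Y11Coeff j b * conj (Y11Coeff i a)))
          * sphereMonomial a b z := (integrable_sphereMonomial a b).const_mul _
  rw [sphereAvg]
  simp only [e]
  rw [integral_finsetSum _ fun a _ => integrable_finsetSum _ fun b _ => hi a b]
  have hs (a : Fin 3) : ∫ z, ∑ b : Fin 3, (1 / 2 * (Y11Coeff j b * conj (Y11Coeff i a)))
      * sphereMonomial a b z = (1 / 2 * (Y11Coeff j a * conj (Y11Coeff i a)))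
        * (Real.pi * ![1 / 3, 1 / 6, 1 / 3] a) := by
    rw [integral_finsetSum _ fun b _ => hi a b, Finset.sum_eq_single a]
    · rw [integral_const_mul, integral_sphereMonomial_self]
    · intro b _ hb
      rw [integral_const_mul, integral_sphereMonomial_of_ne hb.symm, mul_zero]
    · simp
  simp only [hs]
  have hpi : (Real.pi : ℂ) ≠ 0 := by exact_mod_cast Real.pi_ne_zero
  fin_cases i <;> fin_cases j <;> simp [Y11Coeff, Fin.sum_univ_three, conj_ofNat] <;> field_simp <;>
    norm_num

/-! ### The `l = 1` harmonics and the kernel of `ð` -/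

lemma conj_Y10 (i : Fin 3) (z : ℂ) : conj (Y10 i z) = Y10 i z := by
  rw [Y10, map_mul, map_div₀, conj_sphereP, conj_ofReal]
  congr 1
  fin_cases i <;> simp <;> ring

lemma hasWirtingerAt_Y10 (i : Fin 3) (z : ℂ) :
    ∃ q, HasWirtingerAt (Y10 i) (-2 * Y11 i z / sphereP z) q z := by
  have hz := HasWirtingerAt.ident z
  have hc := hasWirtingerAt_conj z
  have hP := sphereP_ne_zero z
  have h2 := ofReal_sqrt_two_ne_zero
  have h3 := ofReal_sqrt_two_sq
  have hN : ∃ q, HasWirtingerAt (fun w : ℂ => ![w + conj w, -I * (w - conj w), w * conj w - 1] i)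
      (![1, -I, conj z] i) q z := by
    fin_cases i
    · exact ⟨_, (hz.add hc).congr_deriv (by simp) rfl⟩
    · exact ⟨_, ((hz.sub hc).const_mul (-I)).congr_deriv (by simp) rfl⟩
    · exact ⟨_, ((hz.mul hc).sub (HasWirtingerAt.const 1 z)).congr_deriv (by simp) rfl⟩
  obtain ⟨q, hN⟩ := hN
  refine ⟨_, (((HasWirtingerAt.const (√2 : ℂ) z).div (hasWirtingerAt_sphereP z) hP).mul
    hN).congr_deriv ?_ rfl⟩
  rw [Y11]
  field_simp
  fin_cases i <;> simp [sphereP] <;> ring_nf <;> rw [h3] <;> ring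

lemma eth_Y10 (i : Fin 3) (z : ℂ) : eth 0 (Y10 i) z = -2 * Y11 i z := by
  obtain ⟨q, h⟩ := hasWirtingerAt_Y10 i z
  have hP := sphereP_ne_zero z
  rw [h.eth]
  field_simp
  simp

lemma smoothSpin_Y10 (i : Fin 3) : SmoothSpin 0 (Y10 i) := by
  have hc : ContDiff ℝ ∞ (Y10 i) := by
    have e : Y10 i = fun z => (√2 : ℂ) * (sphereP z)⁻¹
        * ![z + conj z, -I * (z - conj z), z * conj z - 1] i := by
      ext1 z; rw [Y10, div_eq_mul_inv]
    rw [e]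
    refine ContDiff.mul (contDiff_const.mul (contDiff_sphereP.inv sphereP_ne_zero)) ?_
    fin_cases i
    · exact contDiff_id.add contDiff_conj
    · exact contDiff_const.mul (contDiff_id.sub contDiff_conj)
    · exact (contDiff_id.mul contDiff_conj).sub contDiff_const
  refine ⟨hc, fun z => ![-1, 1, -1] i * Y10 i z, contDiff_const.mul hc, fun z hz => ?_⟩
  have hP := sphereP_ne_zero z
  have hz' : conj z ≠ 0 := (map_ne_zero _).2 hz
  simp only [Y10, sphereP_neg_one_div hz, map_div₀, map_neg, map_one, zpow_zero, one_mul]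
  field_simp
  fin_cases i <;> simp <;> field_simp <;> ring

lemma smoothSpin_Y11 (i : Fin 3) : SmoothSpin 1 (Y11 i) := by
  have h := (smoothSpin_Y10 i).eth.const_mul (-1 / 2)
  have e : (fun z => -1 / 2 * eth 0 (Y10 i) z) = Y11 i := by
    ext1 z; rw [eth_Y10]; ring
  rw [e] at h
  exact h

lemma eth_Y11 (i : Fin 3) (z : ℂ) : eth 1 (Y11 i) z = 0 := by
  have e : (fun w => sphereP w ^ (1 : ℤ) * Y11 i w)
      = fun w => -1 / (√2 : ℂ) * (Y11Coeff i 0 + Y11Coeff i 1 * conj w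
        + Y11Coeff i 2 * (conj w * conj w)) := by
    ext1 w
    have hP := sphereP_ne_zero w
    have h2 := ofReal_sqrt_two_ne_zero
    rw [Y11_eq_sum, zpow_one, Fin.sum_univ_three]
    simp only [Fin.val_zero, Fin.val_one, Fin.val_two, pow_zero, pow_one]
    field_simp
  have hc := hasWirtingerAt_conj z
  rw [eth, e, ((((HasWirtingerAt.const _ z).add (hc.const_mul _)).add
    ((hc.mul hc).const_mul _)).const_mul _).dZeta]
  simp

lemma l1Coeff_sum_Y11 (a : Fin 3 → ℂ) (i : Fin 3) :
    l1Coeff (fun z => ∑ j, a j * Y11 j z) i = a i := by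
  have hs (j : Fin 3) : SmoothSpin 0 (fun z => a j * (Y11 j z * conj (Y11 i z))) := by
    simpa using ((smoothSpin_Y11 j).mul (smoothSpin_Y11 i).star).const_mul (a j)
  have hc (j : Fin 3) : sphereAvg (fun z => a j * (Y11 j z * conj (Y11 i z)))
      = a j * if i = j then 1 / 3 else 0 := by
    rw [← sphereAvg_Y11_mul_conj]
    simp only [sphereAvg, mul_div_assoc]
    rw [integral_const_mul]
    ring
  have e : (fun z => (∑ j, a j * Y11 j z) * conj (Y11 i z))
      = fun z => a 0 * (Y11 0 z * conj (Y11 i z)) + a 1 * (Y11 1 z * conj (Y11 i z))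
        + a 2 * (Y11 2 z * conj (Y11 i z)) := by
    ext1 z; rw [Fin.sum_univ_three]; ring
  rw [l1Coeff, e, sphereAvg_add ((hs 0).add (hs 1)) (hs 2), sphereAvg_add (hs 0) (hs 1), hc, hc, hc]
  fin_cases i <;> simp <;> ring

lemma sum_Y11_eq_zero_iff (a : Fin 3 → ℂ) :
    (∀ z, ∑ j, a j * Y11 j z = 0) ↔ ∀ i, a i = 0 := by
  refine ⟨fun h i => ?_, fun h z => by simp [h]⟩
  rw [← l1Coeff_sum_Y11 a i]
  simp [h, l1Coeff, sphereAvg]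

lemma flatCut_eq (ξ : Fin 4 → ℂ) (z : ℂ) :
    flatCut ξ z = ξ 0 / (√2 : ℂ) - (1 / 2) * ∑ i : Fin 3, ξ i.succ * Y10 i z := by
  have hP := sphereP_ne_zero z
  have h2 := ofReal_sqrt_two_ne_zero
  have h3 := ofReal_sqrt_two_sq
  simp only [flatCut, lHat, Y10, Fin.sum_univ_three, Fin.succ_zero_eq_one, Fin.succ_one_eq_two,
    Matrix.cons_val]
  rw [show ((2 : Fin 3).succ) = (3 : Fin 4) from rfl]
  simp only [Matrix.cons_val]
  have : ξ 0 / (√2 : ℂ) = (√2 : ℂ) / (2 * sphereP z) * (1 + z * conj z) * ξ 0 := by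
    field_simp
    rw [h3, sphereP]
  rw [this]
  field_simp
  ring

lemma conj_flatCut (ξ : Fin 4 → ℂ) (z : ℂ) :
    conj (flatCut ξ z) = flatCut (fun a => conj (ξ a)) z := by
  simp [flatCut_eq, conj_Y10, conj_ofNat]

lemma smoothSpin_flatCut (ξ : Fin 4 → ℂ) : SmoothSpin 0 (flatCut ξ) := by
  have := (SmoothSpin.const (ξ 0 / (√2 : ℂ))).sub ((SmoothSpin.sum Finset.univ
    (f := fun i z => ξ i.succ * Y10 i z)
    fun i _ => (smoothSpin_Y10 i).const_mul (ξ i.succ)).const_mul (1 / 2))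
  convert this using 1
  ext1 z
  exact flatCut_eq ξ z

lemma eth_flatCut (ξ : Fin 4 → ℂ) (z : ℂ) :
    eth 0 (flatCut ξ) z = ∑ i : Fin 3, ξ i.succ * Y11 i z := by
  choose q h using fun i => hasWirtingerAt_Y10 i z
  have e : flatCut ξ = fun z => ξ 0 / (√2 : ℂ) - (1 / 2) * (ξ 1 * Y10 0 z + ξ 2 * Y10 1 z
      + ξ 3 * Y10 2 z) := by
    ext1 z
    rw [flatCut_eq, Fin.sum_univ_three]
    rfl
  have hP := sphereP_ne_zero z
  rw [e, ((HasWirtingerAt.const _ z).sub (((((h 0).const_mul _).add ((h 1).const_mul _)).add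
    ((h 2).const_mul _)).const_mul _)).eth, Fin.sum_univ_three]
  rw [show (Fin.succ 0 : Fin 4) = 1 from rfl, show (Fin.succ 1 : Fin 4) = 2 from rfl,
    show (Fin.succ 2 : Fin 4) = 3 from rfl]
  push_cast
  field_simp
  ring

lemma eth_sum_Y11 (a : Fin 3 → ℂ) (z : ℂ) : eth 1 (fun w => ∑ i, a i * Y11 i w) z = 0 := by
  have hc (i : Fin 3) := (smoothSpin_Y11 i).contDiff
  have h (i : Fin 3) : ContDiff ℝ ∞ fun w => a i * Y11 i w := contDiff_const.mul (hc i)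
  simp only [Fin.sum_univ_three]
  rw [eth_add ((h 0).add (h 1)) (h 2), eth_add (h 0) (h 1), eth_const_mul _ (hc 0),
    eth_const_mul _ (hc 1), eth_const_mul _ (hc 2), eth_Y11, eth_Y11, eth_Y11]
  ring

lemma eth_eth_flatCut (ξ : Fin 4 → ℂ) (z : ℂ) : eth 1 (eth 0 (flatCut ξ)) z = 0 := by
  rw [show eth 0 (flatCut ξ) = _ from funext (eth_flatCut ξ)]
  exact eth_sum_Y11 _ z

/-- The coefficients of a flat cut function, read off from its values at `0, ±1, ±i`. -/
noncomputable def flatCoords (g : ℂ → ℂ) : Fin 4 → ℂ :=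
  ![(g 1 + g (-1)) / (√2 : ℂ), (g (-1) - g 1) / (√2 : ℂ), (g (-I) - g I) / (√2 : ℂ),
    (√2 : ℂ) * g 0 - (g 1 + g (-1)) / (√2 : ℂ)]

lemma flatCoords_flatCut (ξ : Fin 4 → ℂ) : flatCoords (flatCut ξ) = ξ := by
  have h2 := ofReal_sqrt_two_ne_zero
  have h3 := ofReal_sqrt_two_sq
  have s1 : sphereP 1 = 2 := by simp [sphereP]; norm_num
  have s2 : sphereP (-1) = 2 := by simp [sphereP]; norm_num
  have s3 : sphereP I = 2 := by simp [sphereP]; norm_num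
  have s4 : sphereP (-I) = 2 := by simp [sphereP]; norm_num
  have s5 : sphereP 0 = 1 := by simp [sphereP]
  ext a
  fin_cases a <;>
    simp [flatCoords, flatCut, lHat, Fin.sum_univ_three, s1, s2, s3, s4, s5,
      show (Fin.succ 1 : Fin 4) = 2 from rfl, show (Fin.succ 2 : Fin 4) = 3 from rfl] <;>
    field_simp <;> ring_nf <;> simp [h3] <;> ring

lemma flatCut_injective : Function.Injective flatCut :=
  Function.LeftInverse.injective flatCoords_flatCut

lemma HasWirtingerAt.hasDerivAt {f : ℂ → ℂ} {p z : ℂ} (h : HasWirtingerAt f p 0 z) :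
    HasDerivAt f p z := by
  have : HasFDerivAt f (ContinuousLinearMap.toSpanSingleton ℂ p) z :=
    hasFDerivAt_of_restrictScalars ℝ h (by ext; simp [mul_comm])
  simpa using this.hasDerivAt

/-- Liouville's theorem for entire functions of polynomial growth. -/
lemma exists_eq_sum_of_growth (n : ℕ) {F : ℂ → ℂ} (hF : Differentiable ℂ F) {C : ℝ}
    (hC : ∀ z, ‖F z‖ ≤ C * (1 + ‖z‖) ^ n) :
    ∃ a : ℕ → ℂ, ∀ z, F z = ∑ k ∈ Finset.range (n + 1), a k * z ^ k := by
  induction n generalizing F C with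
  | zero =>
    have hb : Bornology.IsBounded (Set.range F) := by
      refine (Metric.isBounded_closedBall (x := (0 : ℂ)) (r := C)).subset ?_
      rintro _ ⟨z, rfl⟩
      simpa using hC z
    exact ⟨fun _ => F 0, fun z => by simpa using hF.apply_eq_apply_of_bounded hb z 0⟩
  | succ n ih =>
    have hD : Differentiable ℂ (dslope F 0) := by
      rw [← differentiableOn_univ]
      exact (Complex.differentiableOn_dslope univ_mem).2 hF.differentiableOn
    obtain ⟨C', hC'⟩ := (isCompact_closedBall (0 : ℂ) 1).exists_bound_of_continuousOn
      hD.continuous.continuousOn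
    have hC0 : 0 ≤ C := by simpa using (norm_nonneg _).trans (hC 0)
    have hm (z : ℂ) : z * dslope F 0 z = F z - F 0 := by
      have := sub_smul_dslope F 0 z
      simpa using this
    obtain ⟨a, ha⟩ := ih hD (C := max C' (4 * C)) fun z => by
      have h1 : 1 ≤ (1 + ‖z‖) ^ n := one_le_pow₀ (by linarith [norm_nonneg z])
      rcases le_total ‖z‖ 1 with hz | hz
      · calc ‖dslope F 0 z‖ ≤ C' := hC' z (by simpa using hz)
          _ ≤ max C' (4 * C) := le_max_left _ _
          _ ≤ _ := le_mul_of_one_le_right (le_max_of_le_right (by positivity)) h1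
      · have h2 : ‖z‖ * ‖dslope F 0 z‖ ≤ 4 * C * (1 + ‖z‖) ^ n * ‖z‖ := by
          rw [← norm_mul, hm]
          have h3 : ‖F 0‖ ≤ C := by simpa using hC 0
          have h4 := hC z
          rw [pow_succ] at h4
          have h5 : 0 ≤ C * (1 + ‖z‖) ^ n := by positivity
          have h6 : C ≤ C * (1 + ‖z‖) ^ n := le_mul_of_one_le_right hC0 h1
          refine (norm_sub_le _ _).trans ?_
          nlinarith [mul_le_mul_of_nonneg_left hz h5]
        have h7 : ‖dslope F 0 z‖ ≤ 4 * C * (1 + ‖z‖) ^ n := by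
          rw [mul_comm] at h2
          exact le_of_mul_le_mul_right h2 (by linarith)
        exact h7.trans (mul_le_mul_of_nonneg_right (le_max_right _ _) (by positivity))
    refine ⟨fun k => if k = 0 then F 0 else a (k - 1), fun z => ?_⟩
    rw [Finset.sum_range_succ']
    have : F z = z * dslope F 0 z + F 0 := by rw [hm]; ring
    rw [this, ha, Finset.mul_sum]
    simp only [Nat.add_eq_zero_iff, one_ne_zero, and_false, if_false, Nat.add_sub_cancel, if_true,
      pow_zero, mul_one]
    congr 1
    exact Finset.sum_congr rfl fun k _ => by ring

/-- The kernel of `ð` in spin weight zero consists of the constants. -/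
lemma exists_eq_const_of_eth_eq_zero {g : ℂ → ℂ} (hg : SmoothSpin 0 g) (h : ∀ z, eth 0 g z = 0) :
    ∃ c, ∀ z, g z = c := by
  obtain ⟨C, hC⟩ := hg.exists_norm_le
  have hW (z : ℂ) : HasDerivAt (fun w => conj (g w)) (conj (dZetaBar g z)) z := by
    have h1 := hg.contDiff.hasWirtingerAt z
    have h2 := h z
    rw [h1.eth] at h2
    have h3 : dZeta g z = 0 := by simpa [sphereP_ne_zero z] using h2
    rw [h3] at h1
    exact (h1.star.congr_deriv rfl (map_zero _)).hasDerivAt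
  obtain ⟨a, ha⟩ := exists_eq_sum_of_growth 0 (fun z => (hW z).differentiableAt) (C := C)
    fun z => by simpa using hC z
  refine ⟨conj (a 0), fun z => ?_⟩
  rw [← conj_conj (g z), ha]
  simp

/-- The kernel of `ð` in spin weight one is spanned by the `Y¹_{1i}`. -/
lemma exists_eq_sum_Y11_of_eth_eq_zero {η : ℂ → ℂ} (hη : SmoothSpin 1 η) (h : ∀ z, eth 1 η z = 0) :
    ∃ a : Fin 3 → ℂ, ∀ z, η z = ∑ i, a i * Y11 i z := by
  obtain ⟨C, hC⟩ := hη.exists_norm_le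
  have hC0 : 0 ≤ C := (norm_nonneg _).trans (hC 0)
  -- `P η` is antiholomorphic and of quadratic growth
  have hW (z : ℂ) : ∃ q, HasDerivAt (fun w => conj (sphereP w * η w)) q z := by
    have h1 := (hasWirtingerAt_sphereP z).mul (hη.contDiff.hasWirtingerAt z)
    have h2 := h z
    simp only [eth, sub_self, zpow_zero, one_mul, zpow_one] at h2
    rw [h1.dZeta] at h2
    exact ⟨_, (h1.star.congr_deriv rfl (by rw [h2, map_zero])).hasDerivAt⟩
  obtain ⟨c, hc⟩ := exists_eq_sum_of_growth 2 (fun z => (hW z).choose_spec.differentiableAt)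
    (C := C) fun z => by
      rw [RCLike.norm_conj, norm_mul, norm_sphereP, mul_comm]
      exact mul_le_mul (hC z) (by nlinarith [norm_nonneg z]) (by positivity) hC0
  have h2 := ofReal_sqrt_two_ne_zero
  have h3 := ofReal_sqrt_two_sq
  refine ⟨![(√2 : ℂ) / 2 * (conj (c 2) - conj (c 0)), -I * ((√2 : ℂ) / 2) *
    (conj (c 0) + conj (c 2)), -conj (c 1) / (√2 : ℂ)], fun z => ?_⟩
  have hP := sphereP_ne_zero z
  have e : sphereP z * η z = conj (c 0) + conj (c 1) * conj z + conj (c 2) * conj z ^ 2 := by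
    rw [← conj_conj (sphereP z * η z), hc]
    simp [Finset.sum_range_succ]
  refine mul_left_cancel₀ hP (e.trans ?_)
  simp only [Fin.sum_univ_three, Y11, Matrix.cons_val]
  field_simp
  rw [h3]
  linear_combination (2 * (conj (c 0) + conj (c 2)) * (1 + conj z ^ 2)) * I_sq

/-- The regular solutions of the homogeneous good cut equation are the flat cut functions. -/
lemma exists_eq_flatCut_of_eth_eth_eq_zero {g : ℂ → ℂ} (hg : SmoothSpin 0 g)
    (h : ∀ z, eth 1 (eth 0 g) z = 0) : ∃ ξ : Fin 4 → ℂ, g = flatCut ξ := by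
  obtain ⟨a, ha⟩ := exists_eq_sum_Y11_of_eth_eq_zero (η := eth 0 g) hg.eth h
  have hf := smoothSpin_flatCut ![0, a 0, a 1, a 2]
  obtain ⟨c, hc⟩ := exists_eq_const_of_eth_eq_zero (hg.sub hf) fun z => by
    rw [eth_sub hg.contDiff hf.contDiff, ha, eth_flatCut, sub_eq_zero]
    simp [Fin.sum_univ_three]
  refine ⟨![(√2 : ℂ) * c, a 0, a 1, a 2], funext fun z => ?_⟩
  have h1 := hc z
  have h2 := ofReal_sqrt_two_ne_zero
  rw [flatCut_eq] at h1 ⊢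
  rw [sub_eq_iff_eq_add.1 h1]
  simp only [Fin.sum_univ_three, Fin.succ_zero_eq_one, Fin.succ_one_eq_two,
    show (Fin.succ 2 : Fin 4) = 3 from rfl, Matrix.cons_val]
  field_simp
  ring

/-! ### The real potential of an electric shear -/

/-- On one stereographic chart, a shear `σ` with real `ð̄²σ` has a real potential. With `e = f/P`
and `q = σ/P` the equation reads `∂²f = q`; the function `V = ∂∂̄f`, then `∂f`, then `f` are found
by the Poincaré lemma, whose first closedness condition is the reality of `∂̄²q`. -/
lemma exists_potential_on_chart {σ : ℂ → ℂ} (hσ : ContDiff ℝ ∞ σ)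
    (hr : ∀ z, conj (ethBar 1 (ethBar 2 σ) z) = ethBar 1 (ethBar 2 σ) z) :
    ∃ e : ℂ → ℝ, ContDiff ℝ ∞ (fun z => (e z : ℂ)) ∧
      ∀ z, eth 1 (eth 0 fun w => (e w : ℂ)) z = σ z := by
  have hP := sphereP_ne_zero
  have hPinv : ContDiff ℝ ∞ fun z => (sphereP z)⁻¹ := contDiff_sphereP.inv hP
  set q : ℂ → ℂ := fun z => (sphereP z)⁻¹ * σ z with hq
  have hqc : ContDiff ℝ ∞ q := hPinv.mul hσ
  have hσq : σ = fun z => sphereP z * q z := by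
    ext1 z; rw [hq]; field_simp [hP z]
  obtain ⟨V, hV, hV1⟩ := exists_real_dZeta_eq hqc.dZetaBar fun z => by
    have := hr z
    rw [hσq, ethBar_ethBar_eq hqc, map_mul, map_pow, conj_sphereP] at this
    exact mul_left_cancel₀ (pow_ne_zero 3 (hP z)) this
  obtain ⟨w, hw, hw1, hw2⟩ := exists_dZeta_eq_dZetaBar_eq hqc hV fun z => (hV1 z).symm
  obtain ⟨f, hf, hf1⟩ := exists_real_dZeta_eq hw fun z => by rw [hw2, conj_ofReal]
  have he (z : ℂ) : ((f z / (1 + ‖z‖ ^ 2) : ℝ) : ℂ) = (f z : ℂ) * (sphereP z)⁻¹ := by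
    rw [sphereP_eq_ofReal]; push_cast; ring
  have hec : ContDiff ℝ ∞ fun z => ((f z / (1 + ‖z‖ ^ 2) : ℝ) : ℂ) := by
    simp only [he]; exact hf.mul hPinv
  refine ⟨fun z => f z / (1 + ‖z‖ ^ 2), hec, fun z => ?_⟩
  rw [eth_eth_eq isOpen_univ (fun z _ => hec.contDiffAt) (Set.mem_univ z)]
  have e1 : (fun w => sphereP w * ((f w / (1 + ‖w‖ ^ 2) : ℝ) : ℂ)) = fun w => (f w : ℂ) := by
    ext1 w; rw [he]; field_simp [hP w]
  rw [e1, show dZeta (fun w => (f w : ℂ)) = w from funext hf1, hw1, hσq]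

/-- `ð̄` commutes with the passage to the coordinate `-1/ζ`. -/
lemma ethBar_neg_one_div {s : ℤ} {η η' : ℂ → ℂ}
    (h : ∀ z : ℂ, z ≠ 0 → η' (-1 / z) = (z / conj z) ^ s * η z) {z : ℂ} (hz : z ≠ 0)
    (hd : ContDiff ℝ ∞ η) :
    ethBar s η' (-1 / z) = (z / conj z) ^ (s - 1) * ethBar s η z := by
  have := eth_neg_one_div (s := -s) (η := fun z => conj (η z)) (η' := fun z => conj (η' z))
    (fun z hz => by rw [h z hz, map_mul, conj_div_conj_zpow]) hz
    (hd.star.differentiable (by simp) z)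
  have h2 := congrArg conj this
  rw [map_mul, conj_div_conj_zpow, conj_eth, conj_eth] at h2
  simp only [neg_neg, conj_conj, neg_add_rev] at h2
  rw [h2]
  congr 2
  ring

/-- A shear on the sphere with real `ð̄²σ` is purely electric: it has a global smooth real
potential. The potentials found on the two charts differ on the overlap by a combination of
`l = 0, 1` harmonics, which is smooth on the whole sphere. -/
lemma exists_potential {σ : ℂ → ℂ} (hσ : SmoothSpin 2 σ)
    (hr : ∀ z, conj (ethBar 1 (ethBar 2 σ) z) = ethBar 1 (ethBar 2 σ) z) :
    ∃ e : ℂ → ℝ, SmoothSpin 0 (fun z => (e z : ℂ)) ∧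
      ∀ z, eth 1 (eth 0 fun w => (e w : ℂ)) z = σ z := by
  obtain ⟨hσc, σ', hσ', hrel⟩ := hσ
  have hP := sphereP_ne_zero
  have hν (z : ℂ) (hz : z ≠ 0) : -1 / (-1 / z) = z := by field_simp
  have hν0 (z : ℂ) (hz : z ≠ 0) : -1 / z ≠ 0 := div_ne_zero (by simp) hz
  have hr' : ∀ z, conj (ethBar 1 (ethBar 2 σ') z) = ethBar 1 (ethBar 2 σ') z := by
    have hc : Continuous (ethBar 1 (ethBar 2 σ')) := ((hσ'.ethBar 2).ethBar 1).continuous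
    have := Continuous.ext_on (dense_compl_singleton (0 : ℂ)) (continuous_conj.comp hc) hc
      fun w hw => by
        have h1 : ∀ z : ℂ, z ≠ 0 → ethBar 2 σ' (-1 / z) = (z / conj z) ^ (1 : ℤ) * ethBar 2 σ z :=
          fun z hz => ethBar_neg_one_div hrel hz hσc
        have h2 := ethBar_neg_one_div h1 (hν0 w hw) (hσc.ethBar 2)
        rw [hν w hw, sub_self, zpow_zero, one_mul] at h2
        rw [Function.comp_apply, h2, hr]
    exact fun z => congrFun this z
  obtain ⟨e₁, he₁, hp₁⟩ := exists_potential_on_chart hσc hr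
  obtain ⟨e₂, he₂, hp₂⟩ := exists_potential_on_chart hσ' hr'
  have hS : IsOpen ({0}ᶜ : Set ℂ) := isOpen_compl_singleton
  have hSc : IsPreconnected ({0}ᶜ : Set ℂ) :=
    (isConnected_compl_singleton_of_one_lt_rank (by simp) 0).isPreconnected
  -- the second potential in the coordinate of the first chart
  set g : ℂ → ℂ := fun z => (e₂ (-1 / z) : ℂ) with hg
  have hgc : ∀ z ∈ ({0}ᶜ : Set ℂ), ContDiffAt ℝ ∞ g z := fun z hz =>
    ContDiffAt.comp z (f := fun z : ℂ => -1 / z) (g := fun z => (e₂ z : ℂ)) he₂.contDiffAt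
      (by
        simp only [div_eq_mul_inv]
        exact contDiffAt_const.mul ((contDiffAt_inv ℂ hz).restrict_scalars ℝ))
  have hgeth : ∀ z ∈ ({0}ᶜ : Set ℂ), eth 1 (eth 0 g) z = σ z := fun z hz => by
    have h1 : ∀ z : ℂ, z ≠ 0 →
        eth 0 (fun w => (e₂ w : ℂ)) (-1 / z) = (z / conj z) ^ (1 : ℤ) * eth 0 g z :=
      fun z hz => eth_neg_one_div (s := 0) (fun z _ => by rw [hg]; simp) hz
        ((hgc z hz).differentiableAt (by simp))
    have hd : DifferentiableAt ℝ (eth 0 g) z := by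
      have : eth 0 g = fun w => sphereP w * dZeta g w := by ext1 w; simp [eth]
      rw [this]
      exact (contDiff_sphereP.contDiffAt.mul (hgc z hz).dZeta).differentiableAt (by simp)
    have h2 := eth_neg_one_div h1 hz hd
    rw [hp₂, hrel z hz] at h2
    exact (mul_left_cancel₀ (zpow_ne_zero _ (div_ne_zero hz ((map_ne_zero _).2 hz))) h2).symm
  set D : ℂ → ℂ := fun z => sphereP z * e₁ z - sphereP z * g z with hD
  have hA : ContDiff ℝ ∞ fun z => sphereP z * (e₁ z : ℂ) := contDiff_sphereP.mul he₁
  have hB : ∀ z ∈ ({0}ᶜ : Set ℂ), ContDiffAt ℝ ∞ (fun z => sphereP z * g z) z := fun z hz =>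
    contDiff_sphereP.contDiffAt.mul (hgc z hz)
  have hD1 : ∀ z ∈ ({0}ᶜ : Set ℂ), dZeta (dZeta D) z = 0 := fun z hz => by
    have ev : dZeta D =ᶠ[𝓝 z] fun w => dZeta (fun z => sphereP z * (e₁ z : ℂ)) w
        - dZeta (fun z => sphereP z * g z) w :=
      (hS.eventually_mem hz).mono fun w hw =>
        ((hA.hasWirtingerAt w).sub (hB w hw).hasWirtingerAt).dZeta
    rw [ev.dZeta_eq, ((hA.dZeta.hasWirtingerAt z).sub (hB z hz).dZeta.hasWirtingerAt).dZeta]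
    have k1 := hp₁ z
    have k2 := hgeth z hz
    rw [eth_eth_eq hS (fun z _ => he₁.contDiffAt) hz] at k1
    rw [eth_eth_eq hS hgc hz, ← k1] at k2
    rw [mul_left_cancel₀ (hP z) k2, sub_self]
  have hDreal : D = fun z => conj (D z) := by
    ext1 z
    simp only [hD, hg, map_sub, map_mul, conj_sphereP, conj_ofReal]
  have hD2 : ∀ z ∈ ({0}ᶜ : Set ℂ), dZetaBar (dZetaBar D) z = 0 := fun z hz => by
    have : dZetaBar D = fun z => conj (dZeta D z) := by
      ext1 w
      conv_lhs => rw [hDreal]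
      exact dZetaBar_conj D w
    rw [this, dZetaBar_conj, hD1 z hz, map_zero]
  obtain ⟨a, b, b', c, hform⟩ := exists_eq_bilinear_of_dZeta_sq_eq_zero hS hSc
    (fun z hz => hA.contDiffAt.sub (hB z hz)) hD1 hD2
  refine ⟨e₁, ⟨he₁, fun w => (e₂ w : ℂ) + (a * (w * conj w) - b * conj w - b' * w + c)
    * (sphereP w)⁻¹, ?_, fun z hz => ?_⟩, hp₁⟩
  · exact he₂.add (ContDiff.mul ((((contDiff_const.mul (contDiff_id.mul contDiff_conj)).sub
      (contDiff_const.mul contDiff_conj)).sub (contDiff_const.mul contDiff_id)).add contDiff_const)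
      (contDiff_sphereP.inv hP))
  · have h1 := hform z hz
    have hz' : conj z ≠ 0 := (map_ne_zero _).2 hz
    simp only [hg] at h1
    have h2 := hP z
    simp only [zpow_zero, one_mul, sphereP_neg_one_div hz, map_div₀, map_neg, map_one]
    generalize (e₂ (-1 / z) : ℂ) = t at h1 ⊢
    field_simp
    linear_combination -h1

lemma eth_eth_const_mul (c : ℂ) {g : ℂ → ℂ} (hg : SmoothSpin 0 g) (z : ℂ) :
    eth 1 (eth 0 fun w => c * g w) z = c * eth 1 (eth 0 g) z := by
  rw [show (eth 0 fun w => c * g w) = fun w => c * eth 0 g w from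
    funext fun w => eth_const_mul c hg.contDiff w, eth_const_mul c hg.eth.contDiff]

lemma eth_eth_add {g h : ℂ → ℂ} (hg : SmoothSpin 0 g) (hh : SmoothSpin 0 h) (z : ℂ) :
    eth 1 (eth 0 fun w => g w + h w) z = eth 1 (eth 0 g) z + eth 1 (eth 0 h) z := by
  rw [show (eth 0 fun w => g w + h w) = fun w => eth 0 g w + eth 0 h w from
    funext fun w => eth_add hg.contDiff hh.contDiff w, eth_add hg.eth.contDiff hh.eth.contDiff]

/-- A smooth real function `b` for which `i ð²b` is also of the form `ð²e` with real `e` is a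
combination of `l = 0, 1` harmonics. -/
lemma magnetic_eq_zero {e b : ℂ → ℝ} (he : SmoothSpin 0 (fun z => (e z : ℂ)))
    (hb : SmoothSpin 0 (fun z => (b z : ℂ)))
    (h : ∀ z, eth 1 (eth 0 fun w => (e w : ℂ)) z + I * eth 1 (eth 0 fun w => (b w : ℂ)) z = 0)
    (z : ℂ) : eth 1 (eth 0 fun w => (b w : ℂ)) z = 0 := by
  obtain ⟨ξ, hξ⟩ := exists_eq_flatCut_of_eth_eth_eq_zero (he.add (hb.const_mul I)) fun z => by
    rw [eth_eth_add he (hb.const_mul I), eth_eth_const_mul I hb, h]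
  have e1 : (fun w => (b w : ℂ))
      = fun w => -I / 2 * flatCut ξ w + I / 2 * flatCut (fun a => conj (ξ a)) w := by
    ext1 w
    rw [← conj_flatCut, ← hξ]
    simp only [map_add, map_mul, conj_I, conj_ofReal]
    linear_combination (b w : ℂ) * I_sq
  rw [e1, eth_eth_add ((smoothSpin_flatCut _).const_mul _) ((smoothSpin_flatCut _).const_mul _),
    eth_eth_const_mul _ (smoothSpin_flatCut _), eth_eth_const_mul _ (smoothSpin_flatCut _),
    eth_eth_flatCut, eth_eth_flatCut]
  ring

lemma ofReal_translation (b : Fin 4 → ℝ) (z : ℂ) :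
    (translation b z : ℂ) = flatCut (fun a => (b a : ℂ)) z := by
  rw [translation, ← conj_eq_iff_re, conj_flatCut]
  simp

/-! ### Rotations of spin-weighted functions -/

lemma ContDiffAt.zpow_of_ne_zero {E : Type*} [NormedAddCommGroup E] [NormedSpace ℝ E] {f : E → ℂ}
    {x : E} (hf : ContDiffAt ℝ ∞ f x) (h0 : f x ≠ 0) (s : ℤ) :
    ContDiffAt ℝ ∞ (fun y => f y ^ s) x := by
  obtain ⟨n, rfl | rfl⟩ := s.eq_nat_or_neg
  · simpa using hf.pow n
  · simp only [zpow_neg, zpow_natCast]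
    exact (hf.pow n).inv (pow_ne_zero n h0)

/-- The function on `ℂ²`, homogeneous under complex scaling with the phase `(λ/λ̄)^{-s}`, which a
spin-weighted function `η` (with expression `η'` in the chart at infinity) induces in homogeneous
coordinates `ζ = x/y`. -/
noncomputable def spinLift (s : ℤ) (η η' : ℂ → ℂ) (x y : ℂ) : ℂ :=
  open Classical in
  if y = 0 then (x / conj x) ^ (-s) * η' (-y / x) else (y / conj y) ^ (-s) * η (x / y)

lemma spinLift_mul (s : ℤ) (η η' : ℂ → ℂ) {k : ℂ} (hk : k ≠ 0) (x y : ℂ) :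
    spinLift s η η' (k * x) (k * y) = (k / conj k) ^ (-s) * spinLift s η η' x y := by
  have e (w : ℂ) : k * w / conj (k * w) = (k / conj k) * (w / conj w) := by
    rw [map_mul, mul_div_mul_comm]
  unfold spinLift
  by_cases hy : y = 0
  · rw [if_pos hy, if_pos (by simp [hy]), e, mul_zpow, ← mul_neg, mul_div_mul_left _ _ hk]
    ring
  · rw [if_neg hy, if_neg (mul_ne_zero hk hy), e, mul_zpow, mul_div_mul_left _ _ hk]
    ring

lemma spinLift_of_ne_zero {s : ℤ} {η η' : ℂ → ℂ}
    (h : ∀ z : ℂ, z ≠ 0 → η' (-1 / z) = (z / conj z) ^ s * η z) {x : ℂ} (hx : x ≠ 0) (y : ℂ) :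
    spinLift s η η' x y = (x / conj x) ^ (-s) * η' (-y / x) := by
  unfold spinLift
  by_cases hy : y = 0
  · rw [if_pos hy]
  · have hx' : conj x ≠ 0 := (map_ne_zero _).2 hx
    have hy' : conj y ≠ 0 := (map_ne_zero _).2 hy
    have := h (x / y) (div_ne_zero hx hy)
    rw [show -1 / (x / y) = -y / x by field_simp] at this
    rw [if_neg hy, this, ← mul_assoc]
    congr 1
    rw [map_div₀, show x / y / (conj x / conj y) = (x / conj x) * (y / conj y)⁻¹ by field_simp,
      mul_zpow, ← mul_assoc, ← zpow_add₀ (div_ne_zero hx hx'),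
      neg_add_cancel, zpow_zero, one_mul, inv_zpow, zpow_neg]

lemma contDiffAt_spinLift {s : ℤ} {η η' : ℂ → ℂ} (hη : ContDiff ℝ ∞ η) (hη' : ContDiff ℝ ∞ η')
    (h : ∀ z : ℂ, z ≠ 0 → η' (-1 / z) = (z / conj z) ^ s * η z) {p : ℂ × ℂ} (hp : p ≠ 0) :
    ContDiffAt ℝ ∞ (fun p : ℂ × ℂ => spinLift s η η' p.1 p.2) p := by
  have phase {f : ℂ × ℂ → ℂ} (hf : ContDiff ℝ ∞ f) (h0 : f p ≠ 0) :
      ContDiffAt ℝ ∞ (fun r => (f r / conj (f r)) ^ (-s)) p := by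
    have h0' : conj (f p) ≠ 0 := (map_ne_zero _).2 h0
    refine ContDiffAt.zpow_of_ne_zero (f := fun r => f r / conj (f r)) ?_ (div_ne_zero h0 h0') _
    simp only [div_eq_mul_inv]
    exact hf.contDiffAt.mul ((contDiff_conj.comp hf).contDiffAt.inv h0')
  have quot {f g : ℂ × ℂ → ℂ} (hf : ContDiff ℝ ∞ f) (hg : ContDiff ℝ ∞ g) (h0 : g p ≠ 0) :
      ContDiffAt ℝ ∞ (fun r => f r / g r) p := by
    simp only [div_eq_mul_inv]
    exact hf.contDiffAt.mul (hg.contDiffAt.inv h0)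
  by_cases hy : p.2 = 0
  · have hx : p.1 ≠ 0 := fun hx => hp (Prod.ext hx hy)
    refine ContDiffAt.congr_of_eventuallyEq (f := fun p : ℂ × ℂ =>
      (p.1 / conj p.1) ^ (-s) * η' (-p.2 / p.1)) ?_ ?_
    · exact (phase contDiff_fst hx).mul (ContDiffAt.comp p (g := η')
        (f := fun p : ℂ × ℂ => -p.2 / p.1) hη'.contDiffAt (quot contDiff_snd.neg contDiff_fst hx))
    · filter_upwards [(continuous_fst.isOpen_preimage _ isOpen_compl_singleton).mem_nhds hx]
        with r hr
      exact spinLift_of_ne_zero h hr _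
  · refine ContDiffAt.congr_of_eventuallyEq (f := fun p : ℂ × ℂ =>
      (p.2 / conj p.2) ^ (-s) * η (p.1 / p.2)) ?_ ?_
    · exact (phase contDiff_snd hy).mul (ContDiffAt.comp p (g := η)
        (f := fun p : ℂ × ℂ => p.1 / p.2) hη.contDiffAt (quot contDiff_fst contDiff_snd hy))
    · filter_upwards [(continuous_snd.isOpen_preimage _ isOpen_compl_singleton).mem_nhds hy]
        with r hr
      exact if_neg hr

/-- A smooth spin-weighted function stays smooth when expressed in a rotated coordinate. -/
lemma SmoothSpin.exists_rotated {s : ℤ} {η : ℂ → ℂ} (hη : SmoothSpin s η)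
    (A : Matrix (Fin 2) (Fin 2) ℂ) (hA : A.det = 1) :
    ∃ ρ : ℂ → ℂ, SmoothSpin s ρ ∧ SpinRotated A s η ρ := by
  obtain ⟨h1, η', h2, h3⟩ := hη
  rw [Matrix.det_fin_two] at hA
  have hF {p : ℂ × ℂ} (hp : p ≠ 0) := contDiffAt_spinLift h1 h2 h3 hp
  have comp {f g : ℂ → ℂ} (hf : ContDiff ℝ ∞ f) (hg : ContDiff ℝ ∞ g)
      (h0 : ∀ w, f w = 0 → g w = 0 → False) :
      ContDiff ℝ ∞ fun w => spinLift s η η' (f w) (g w) := by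
    refine contDiff_iff_contDiffAt.2 fun w => ?_
    exact ContDiffAt.comp w (f := fun w => (f w, g w)) (hF fun h => h0 w (congrArg Prod.fst h)
      (congrArg Prod.snd h)) (hf.prodMk hg).contDiffAt
  refine ⟨fun w => spinLift s η η' (A 1 1 * w - A 0 1) (A 0 0 - A 1 0 * w),
    ⟨?_, fun v => spinLift s η η' (A 1 1 + A 0 1 * v) (-A 1 0 - A 0 0 * v), ?_, ?_⟩, ?_⟩
  · refine comp ((contDiff_const.mul contDiff_id).sub contDiff_const)
      (contDiff_const.sub (contDiff_const.mul contDiff_id)) fun w ha hb => one_ne_zero (α := ℂ) ?_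
    linear_combination -hA + A 1 0 * ha + A 1 1 * hb
  · refine comp (contDiff_const.add (contDiff_const.mul contDiff_id))
      (contDiff_const.sub (contDiff_const.mul contDiff_id)) fun w ha hb => one_ne_zero (α := ℂ) ?_
    linear_combination -hA + A 0 0 * ha + A 0 1 * hb
  · intro z hz
    have := spinLift_mul s η η' (inv_ne_zero hz) (A 1 1 * z - A 0 1) (A 0 0 - A 1 0 * z)
    rw [map_inv₀, ← inv_div_inv, inv_inv, inv_inv, zpow_neg, ← inv_zpow, inv_div] at this
    refine Eq.trans ?_ this
    have hx : z⁻¹ * (A 1 1 * z - A 0 1) = A 1 1 + A 0 1 * (-1 / z) := by field_simp; ring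
    have hy : z⁻¹ * (A 0 0 - A 1 0 * z) = -A 1 0 - A 0 0 * (-1 / z) := by field_simp; ring
    rw [hx, hy]
  · intro z hz
    have := spinLift_mul s η η' (inv_ne_zero hz) z 1
    rw [map_inv₀, ← inv_div_inv, inv_inv, inv_inv, zpow_neg, ← inv_zpow, inv_div] at this
    have e : spinLift s η η' z 1 = η z := by simp [spinLift]
    rw [e] at this
    rw [← this]
    simp only [mobDenom] at hz
    have hk := inv_mul_cancel₀ hz
    simp only [mob, mobDenom, div_eq_mul_inv]
    congr 1
    · linear_combination (A 1 0 * z + A 1 1)⁻¹ * z * hA + A 0 1 * hk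
    · linear_combination (A 1 0 * z + A 1 1)⁻¹ * hA - A 0 0 * hk

/-- A unit vector of `ℝ³` in terms of the Cayley-Klein parameters of a rotation that carries it to
the north pole `ζ = ∞`. -/
lemma exists_cayleyKlein (n : Fin 3 → ℝ) (hn : ∑ i, n i ^ 2 = 1) :
    ∃ p q : ℂ, p * conj p + q * conj q = 1 ∧ p * conj p - q * conj q = n 2 ∧
      2 * (p * conj q) = n 0 - I * n 1 := by
  rw [Fin.sum_univ_three] at hn
  have h1 : -1 ≤ n 2 := by nlinarith [sq_nonneg (n 0), sq_nonneg (n 1)]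
  rcases h1.eq_or_lt with h | h
  · have h0 : n 0 = 0 := by nlinarith [sq_nonneg (n 0), sq_nonneg (n 1)]
    have h0' : n 1 = 0 := by nlinarith [sq_nonneg (n 0), sq_nonneg (n 1)]
    exact ⟨0, 1, by simp, by simp [← h], by simp [h0, h0']⟩
  · set r := √((1 + n 2) / 2) with hr
    have hr2 : r ^ 2 = (1 + n 2) / 2 := Real.sq_sqrt (by linarith)
    have hr0 : 0 < r := Real.sqrt_pos.2 (by linarith)
    have hrc : (r : ℂ) ^ 2 = (1 + n 2) / 2 := by rw [← ofReal_pow, hr2]; push_cast; ring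
    have hr0c : (r : ℂ) ≠ 0 := by exact_mod_cast hr0.ne'
    have hnc : (n 0 : ℂ) ^ 2 + n 1 ^ 2 + n 2 ^ 2 = 1 := by exact_mod_cast hn
    have hq : (((n 0 : ℂ) + I * n 1) / (2 * r)) * (((n 0 : ℂ) - I * n 1) / (2 * r))
        = (1 - n 2) / 2 := by
      have h3 : (1 + n 2 : ℂ) ≠ 0 := by
        have : (1 + n 2 : ℝ) ≠ 0 := by linarith
        exact_mod_cast this
      have h4 : (((n 0 : ℂ) + I * n 1) / (2 * r)) * (((n 0 : ℂ) - I * n 1) / (2 * r))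
        = ((n 0 : ℂ) ^ 2 + n 1 ^ 2) / (4 * r ^ 2) := by
        field_simp
        linear_combination -4 * (n 1 : ℂ) ^ 2 * I_sq
      rw [h4, hrc]
      field_simp
      linear_combination 4 * hnc
    refine ⟨r, (n 0 + I * n 1) / (2 * r), ?_, ?_, ?_⟩ <;>
      simp only [map_div₀, map_add, map_mul, conj_ofReal, conj_I, conj_ofNat, neg_mul,
        ← sub_eq_add_neg]
    · linear_combination hq + hrc
    · linear_combination hrc - hq
    · field_simp

/-- Every vector `v` of `ℝ³` is carried to `(0, 0, |v|)` by some rotation. The two identities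
express this through the harmonics of spin weight zero and one. -/
lemma exists_rotation_to_axis (v : Fin 3 → ℝ) :
    ∃ (A : Matrix (Fin 2) (Fin 2) ℂ) (a : ℝ), A ∈ Matrix.specialUnitaryGroup (Fin 2) ℂ ∧ 0 ≤ a ∧
      a ^ 2 = ∑ i, v i ^ 2 ∧
      (∀ z, mobDenom A z ≠ 0 → (a : ℂ) * Y10 2 (mob A z) = ∑ i, (v i : ℂ) * Y10 i z) ∧
      SpinRotated A 1 (fun z => ∑ i, (v i : ℂ) * Y11 i z) (fun z => (a : ℂ) * Y11 2 z) := by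
  have hnn : 0 ≤ ∑ i, v i ^ 2 := Finset.sum_nonneg fun i _ => sq_nonneg _
  set a := √(∑ i, v i ^ 2) with ha
  have ha2 : a ^ 2 = ∑ i, v i ^ 2 := Real.sq_sqrt hnn
  rcases (Real.sqrt_nonneg (∑ i, v i ^ 2)).eq_or_lt with h | h
  · have hv : ∀ i, v i = 0 := fun i => by
      have h1 : ∑ i, v i ^ 2 = 0 := by rw [← ha2, ha, ← h]; norm_num
      have := (Finset.sum_eq_zero_iff_of_nonneg fun i _ => sq_nonneg (v i)).1 h1 i
        (Finset.mem_univ i)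
      exact pow_eq_zero_iff two_ne_zero |>.1 this
    refine ⟨1, a, one_mem _, Real.sqrt_nonneg _, ha2, fun z _ => ?_, fun z _ => ?_⟩ <;>
      simp [hv, ha]
  · obtain ⟨p, q, h1, h2, h3⟩ := exists_cayleyKlein (fun i => v i / a) (by
      simp only [div_pow, ← Finset.sum_div, ← ha2]
      exact div_self (pow_ne_zero 2 h.ne'))
    have ha0 : (a : ℂ) ≠ 0 := by exact_mod_cast h.ne'
    push_cast at h2 h3
    have hv2 : (v 2 : ℂ) = a * (p * conj p - q * conj q) := by rw [h2]; field_simp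
    have h3' : 2 * (conj p * q) = v 0 / a + I * (v 1 / a) := by
      have := congrArg conj h3
      simpa [conj_ofNat] using this
    have hv0 : (v 0 : ℂ) = a * (p * conj q + conj p * q) := by
      have := ha0
      have e : (v 0 : ℂ) / a = p * conj q + conj p * q := by linear_combination -(h3 + h3') / 2
      rw [← e]; field_simp
    have hv1 : (v 1 : ℂ) = a * (I * (p * conj q - conj p * q)) := by
      have e : (v 1 : ℂ) / a = I * (p * conj q - conj p * q) := by
        linear_combination (v 1 / a : ℂ) * I_sq - I * (h3 - h3') / 2
      rw [← e]; field_simp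
    have hSU : !![p, q; -conj q, conj p] ∈ Matrix.specialUnitaryGroup (Fin 2) ℂ := by
      rw [Matrix.mem_specialUnitaryGroup_iff, Matrix.mem_unitaryGroup_iff]
      constructor
      · ext i j
        fin_cases i <;> fin_cases j <;>
          simp [Matrix.mul_apply, Fin.sum_univ_two, Matrix.star_apply] <;>
          first | linear_combination h1 | ring
      · rw [Matrix.det_fin_two]
        simp
        linear_combination h1
    have hM (z : ℂ) : mobDenom !![p, q; -conj q, conj p] z = -conj q * z + conj p := by
      simp [mobDenom]
    have hm (z : ℂ) : mob !![p, q; -conj q, conj p] z = (p * z + q) / (-conj q * z + conj p) := by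
      simp [mob, mobDenom]
    -- the denominator of the fractional linear map and its conjugate, kept opaque for `field_simp`
    have hD (z : ℂ) (hz : -conj q * z + conj p ≠ 0) : ∃ d d' : ℂ, d ≠ 0 ∧ d' ≠ 0 ∧
        d = -conj q * z + conj p ∧ d' = -q * conj z + p ∧ conj d = d' := by
      have := (map_ne_zero conj).2 hz
      exact ⟨_, _, hz, by simpa using this, rfl, rfl, by simp⟩
    have hPm (z d d' : ℂ) (hd0 : d ≠ 0) (hd0' : d' ≠ 0) (hd : d = -conj q * z + conj p)
        (hd' : d' = -q * conj z + p) (hdd : conj d = d') :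
        sphereP ((p * z + q) / d) = sphereP z / (d * d') := by
      simp only [sphereP, map_div₀, map_add, map_mul, hdd]
      field_simp
      rw [hd, hd']
      linear_combination (1 + z * conj z) * h1
    refine ⟨!![p, q; -conj q, conj p], a, hSU, Real.sqrt_nonneg _, ha2, fun z hz => ?_,
      fun z hz => ?_⟩
    · rw [hM] at hz
      obtain ⟨d, d', hd0, hd0', hd, hd', hdd⟩ := hD z hz
      have hP := sphereP_ne_zero z
      rw [hm, Fin.sum_univ_three, hv0, hv1, hv2, ← hd]
      simp only [Y10, hPm z d d' hd0 hd0' hd hd' hdd, Matrix.cons_val, map_div₀, map_add, map_mul,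
        hdd]
      field_simp
      rw [hd, hd']
      linear_combination (z - conj z) * (p * conj q - conj p * q) * I_sq
    · rw [hM] at hz ⊢
      obtain ⟨d, d', hd0, hd0', hd, hd', hdd⟩ := hD z hz
      have hP := sphereP_ne_zero z
      have h2 := ofReal_sqrt_two_ne_zero
      simp only [hm, Fin.sum_univ_three, hv0, hv1, hv2, zpow_one, ← hd]
      simp only [Y11, hPm z d d' hd0 hd0' hd hd' hdd, Matrix.cons_val, map_div₀, map_add, map_mul,
        hdd]
      field_simp
      rw [hd']
      linear_combination -(1 + conj z ^ 2) * (p * conj q - conj p * q) * I_sq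

/-! ### Stationary vacuum data -/

namespace ScriData

lemma uDot_eq_zero {f : ℝ → ℂ → ℂ} (h : ∀ u v ζ, f u ζ = f v ζ) (u : ℝ) (ζ : ℂ) :
    uDot f u ζ = 0 := by
  rw [uDot, show (fun v => f v ζ) = fun _ => f u ζ from funext fun v => h v u ζ]
  exact deriv_const _ _

variable {d : ScriData}

lemma IsStationary.uDot_σbar (hs : d.IsStationary) : uDot d.σbar = fun _ _ => 0 :=
  funext fun u => funext fun ζ => uDot_eq_zero (fun u v ζ => by rw [σbar, σbar, (hs u v ζ).1]) u ζ

/-- The asymptotic vacuum equations for time-independent data. -/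
lemma IsVacuum.stationary_equations (hv : d.IsVacuum) (hs : d.IsStationary) (u : ℝ) (ζ : ℂ) :
    d.ψ3 u ζ = 0 ∧ d.ψ4 u ζ = 0 ∧ eth 0 (d.ψ2 u) ζ = 0 ∧
      eth 1 (d.ψ1 u) ζ = 3 * d.σ u ζ * d.ψ2 u ζ := by
  have h3 : d.ψ3 u ζ = 0 := by
    rw [hv.ψ3_eq, hs.uDot_σbar]
    exact eth_zero_fun ζ
  have h4 : d.ψ4 u ζ = 0 := by
    rw [hv.ψ4_eq, hs.uDot_σbar, uDot_eq_zero (fun _ _ _ => rfl), neg_zero]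
  refine ⟨h3, h4, ?_, ?_⟩
  · have := hv.bianchi1 u ζ
    rw [uDot_eq_zero (fun u v ζ => (hs u v ζ).2.2.1), h3] at this
    linear_combination this
  · have := hv.bianchi0 u ζ
    rw [uDot_eq_zero (fun u v ζ => (hs u v ζ).2.1)] at this
    linear_combination this

lemma massAspect_of_stationary (hs : d.IsStationary) (u : ℝ) :
    d.massAspect u = fun ζ => d.ψ2 u ζ + eth (-1) (eth (-2) (d.σbar u)) ζ := by
  ext1 ζ
  rw [massAspect, hs.uDot_σbar, mul_zero, add_zero]

lemma conj_eth_eth_σbar (u : ℝ) (ζ : ℂ) :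
    conj (eth (-1) (eth (-2) (d.σbar u)) ζ) = ethBar 1 (ethBar 2 (d.σ u)) ζ := by
  rw [conj_eth]
  congr 1
  ext1 w
  rw [conj_eth]
  simp [σbar]

lemma IsVacuum.smoothSpin_eth_eth_σbar (hv : d.IsVacuum) (u : ℝ) :
    SmoothSpin (-1) (eth (-2) (d.σbar u)) :=
  SmoothSpin.eth (smoothSpin_of_field hv.smooth_σ u).star

/-- In stationary vacuum data `ψ₂⁰` is a real constant, which determines the Bondi mass. -/
lemma IsVacuum.exists_ψ2_eq (hv : d.IsVacuum) (hs : d.IsStationary) :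
    ∃ k : ℝ, (∀ u ζ, d.ψ2 u ζ = k) ∧ ∀ u, sphereAvg (d.massAspect u) = k := by
  obtain ⟨k, hk0⟩ := exists_eq_const_of_eth_eq_zero (smoothSpin_of_field hv.smooth_ψ2 0)
    fun ζ => (hv.stationary_equations hs 0 ζ).2.2.1
  have hk (u : ℝ) (ζ : ℂ) : d.ψ2 u ζ = k := by rw [(hs u 0 ζ).2.2.2.1, hk0]
  have havg (u : ℝ) : sphereAvg (d.massAspect u) = k := by
    have h1 := hv.smoothSpin_eth_eth_σbar u
    rw [massAspect_of_stationary hs]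
    simp only [hk]
    rw [sphereAvg_add (SmoothSpin.const k) h1.eth, sphereAvg_const, sphereAvg_eth_neg_one h1,
      add_zero]
  have hreal : conj k = k := by
    rw [← havg 0, sphereAvg, map_mul, ← integral_conj]
    simp only [map_div₀, map_pow, conj_sphereP, hv.reality, map_one, conj_ofReal]
  have hkk : ((k.re : ℝ) : ℂ) = k := conj_eq_iff_re.1 hreal
  exact ⟨k.re, fun u ζ => by rw [hk, hkk], fun u => by rw [havg, hkk]⟩

lemma IsVacuum.exists_bondiMass (hv : d.IsVacuum) (hs : d.IsStationary) {c G : ℝ} (hc : 0 < c)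
    (hG : 0 < G) : ∃ M : ℝ, (∀ u, d.bondiMass c G u = M) ∧
      ∀ u ζ, d.ψ2 u ζ = ((-(2 * √2 * G / c ^ 2) * M : ℝ) : ℂ) := by
  obtain ⟨k, hk, havg⟩ := hv.exists_ψ2_eq hs
  refine ⟨-(c ^ 2 / (2 * √2 * G)) * k, fun u => ?_, fun u ζ => ?_⟩
  · rw [bondiMass, havg, ofReal_re]
  · rw [hk]
    congr 1
    have : √2 ≠ 0 := by positivity
    field_simp

lemma IsVacuum.bondiMass_eq (hv : d.IsVacuum) (hs : d.IsStationary) {c G M : ℝ} (hc : 0 < c)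
    (hG : 0 < G) (hM : ∀ u ζ, d.ψ2 u ζ = ((-(2 * √2 * G / c ^ 2) * M : ℝ) : ℂ)) (u : ℝ) :
    d.bondiMass c G u = M := by
  obtain ⟨M', h1, h2⟩ := hv.exists_bondiMass hs hc hG
  have h3 := (h2 0 0).symm.trans (hM 0 0)
  have h4 : -(2 * √2 * G / c ^ 2) ≠ 0 := neg_ne_zero.2 (by positivity)
  rw [h1]
  exact mul_left_cancel₀ h4 (ofReal_inj.1 h3)

/-- In stationary vacuum data the shear satisfies `ð̄²σ = ð²σ̄`: it has no magnetic part. -/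
lemma IsVacuum.conj_ethBar_ethBar_σ (hv : d.IsVacuum) (hs : d.IsStationary) (u : ℝ) (ζ : ℂ) :
    conj (ethBar 1 (ethBar 2 (d.σ u)) ζ) = ethBar 1 (ethBar 2 (d.σ u)) ζ := by
  obtain ⟨k, hk, -⟩ := hv.exists_ψ2_eq hs
  have h := hv.reality u ζ
  rw [massAspect_of_stationary hs] at h
  simp only [map_add, hk, conj_ofReal, add_right_inj] at h
  rw [← conj_eth_eth_σbar, conj_conj, h]

/-- Time-independent data with vanishing `σ⁰`, `ψ₃⁰`, `ψ₄⁰` and constant `ψ₂⁰ = k`. -/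
def stationaryData (ψ0 ψ1 : ℂ → ℂ) (k : ℂ) : ScriData :=
  { σ := fun _ _ => 0
    ψ0 := fun _ => ψ0
    ψ1 := fun _ => ψ1
    ψ2 := fun _ _ => k
    ψ3 := fun _ _ => 0
    ψ4 := fun _ _ => 0 }

lemma isStationary_stationaryData (ψ0 ψ1 : ℂ → ℂ) (k : ℂ) :
    (stationaryData ψ0 ψ1 k).IsStationary :=
  fun _ _ _ => ⟨rfl, rfl, rfl, rfl, rfl, rfl⟩

lemma isVacuum_stationaryData {ψ0 ψ1 : ℂ → ℂ} (k : ℝ) (h0 : SmoothSpin 2 ψ0)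
    (h1 : SmoothSpin 1 ψ1) (h2 : ∀ ζ, eth 1 ψ1 ζ = 0) :
    (stationaryData ψ0 ψ1 k).IsVacuum := by
  have hs := isStationary_stationaryData ψ0 ψ1 k
  have hσ (u : ℝ) : (stationaryData ψ0 ψ1 k).σbar u = fun _ => 0 := by
    ext1 ζ; simp [σbar, stationaryData]
  have z (s : ℤ) : eth s (fun _ => 0) = fun _ => 0 := funext fun ζ => eth_zero_fun ζ
  refine ⟨(SmoothSpin.zero 2).field, h0.field, h1.field, (SmoothSpin.const (k : ℂ)).field,
    (SmoothSpin.zero (-1)).field, (SmoothSpin.zero (-2)).field, fun u ζ => ?_, fun u ζ => ?_,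
    fun u ζ => ?_, fun u ζ => ?_, fun u ζ => ?_, fun u ζ => ?_⟩
  · rw [hs.uDot_σbar, uDot_eq_zero (fun _ _ _ => rfl), neg_zero]; rfl
  · rw [hs.uDot_σbar, z]; rfl
  · rw [massAspect_of_stationary hs, hσ, z, z]; simp [stationaryData]
  · rw [uDot_eq_zero (fun _ _ _ => rfl)]; simp [stationaryData]
  · rw [uDot_eq_zero (fun _ _ _ => rfl)]; simp [stationaryData, eth_zero_const]
  · rw [uDot_eq_zero (fun _ _ _ => rfl)]; simp [stationaryData, h2]

/-- A supertranslation that removes the shear brings stationary vacuum data to the form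
`stationaryData`; the Bianchi identity `ðψ₁⁰ = 3σ⁰ψ₂⁰` becomes `ðψ₁⁰ = 0`. -/
lemma IsVacuum.supertranslate_eq (hv : d.IsVacuum) (hs : d.IsStationary) {k : ℝ}
    (hk : ∀ u ζ, d.ψ2 u ζ = k) {α : ℂ → ℝ} (hα : IsSupertranslation α)
    (hσ : ∀ u ζ, (d.supertranslate α).σ u ζ = 0) :
    ∃ ψ0 ψ1 : ℂ → ℂ, SmoothSpin 2 ψ0 ∧ SmoothSpin 1 ψ1 ∧ (∀ ζ, eth 1 ψ1 ζ = 0) ∧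
      (ψ1 = fun ζ => d.ψ1 0 ζ + 3 * k * eth 0 (fun z => (α z : ℂ)) ζ) ∧
      d.supertranslate α = stationaryData ψ0 ψ1 k := by
  have hL : SmoothSpin 1 (eth 0 fun z => (α z : ℂ)) := SmoothSpin.eth hα
  have h0 := smoothSpin_of_field hv.smooth_ψ0 0
  have h1 := smoothSpin_of_field hv.smooth_ψ1 0
  have hψ1 := h1.add (hL.const_mul (3 * k))
  have hψ0 := (h0.add ((hL.mul h1).const_mul 4)).add ((hL.mul hL).const_mul (6 * k))
  have e := hv.stationary_equations hs
  refine ⟨_, _, hψ0, hψ1, fun ζ => ?_, rfl, ?_⟩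
  · have hσ0 := hσ (α ζ) ζ
    simp only [supertranslate, sub_self] at hσ0
    rw [eth_add h1.contDiff (hL.const_mul (3 * k)).contDiff, eth_const_mul _ hL.contDiff,
      (e 0 ζ).2.2.2, hk]
    linear_combination 3 * k * hσ0
  · have e' : ∀ u ζ, d.ψ3 u ζ = 0 ∧ d.ψ4 u ζ = 0 := fun u ζ => ⟨(e u ζ).1, (e u ζ).2.1⟩
    have hσ' : (d.supertranslate α).σ = fun _ _ => 0 := funext fun u => funext fun ζ => hσ u ζ
    rw [show d.supertranslate α = { d.supertranslate α with σ := fun _ _ => 0 } by rw [← hσ']]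
    simp only [supertranslate, stationaryData, nullRotPsi1, mk.injEq, true_and, hk, e']
    refine ⟨?_, ?_, ?_, ?_, trivial⟩ <;> funext u ζ
    · rw [(hs (u - α ζ) 0 ζ).2.1, (hs (u - α ζ) 0 ζ).2.2.1]
      ring
    · rw [(hs (u - α ζ) 0 ζ).2.2.1]
      ring
    · ring
    · ring

/-- For a pure `l = 1` field `ψ₁⁰` with complex dipole `D`, the null rotation to the flat cut with
position `ξ` shifts the dipole by `-M ξ`. -/
lemma nullRotPsi1_flatCut {c G M : ℝ} {D : Fin 3 → ℂ} {ψ0 ψ1 : ℂ → ℂ}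
    (hψ1 : ∀ ζ, ψ1 ζ = ∑ i, (-((6 * √2 * G / c ^ 2 : ℝ) : ℂ) * D i) * Y11 i ζ) (ξ : Fin 4 → ℂ)
    (u : ℝ) :
    (stationaryData ψ0 ψ1 ((-(2 * √2 * G / c ^ 2) * M : ℝ) : ℂ)).nullRotPsi1
        (eth 0 (flatCut ξ)) u
      = fun ζ => ∑ i, (-((6 * √2 * G / c ^ 2 : ℝ) : ℂ) * (D i - M * ξ i.succ)) * Y11 i ζ := by
  ext1 ζ
  simp only [nullRotPsi1, stationaryData, eth_flatCut, hψ1, Fin.sum_univ_three]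
  push_cast
  ring

lemma complexDipole_of_ψ1 {c G : ℝ} (hc : 0 < c) (hG : 0 < G) {D : Fin 3 → ℂ} {d : ScriData}
    {u : ℝ} (h : ∀ ζ, d.ψ1 u ζ = ∑ i, (-((6 * √2 * G / c ^ 2 : ℝ) : ℂ) * D i) * Y11 i ζ)
    (i : Fin 3) : d.complexDipole c G u i = D i := by
  rw [complexDipole, show d.ψ1 u = _ from funext h, l1Coeff_sum_Y11, ← mul_assoc, neg_mul_neg,
    ← ofReal_mul]
  have : c ^ 2 / (6 * √2 * G) * (6 * √2 * G / c ^ 2) = 1 := by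
    have : √2 ≠ 0 := by positivity
    field_simp
  rw [this, ofReal_one, one_mul]

end ScriData

/-! ### Good cut functions of a shear-free frame -/

lemma IsGCF.exists_worldLine {U : Set ℂ} {X : ℂ → ℂ → ℂ} (hX : IsGCF (fun _ => 0) U X) :
    ∃ ξ : ℂ → Fin 4 → ℂ, (∀ a, DifferentiableOn ℂ (fun τ => ξ τ a) U) ∧
      ∀ τ ∈ U, X τ = flatCut (ξ τ) := by
  refine ⟨fun τ => flatCoords (X τ), fun a => ?_, fun τ hτ => ?_⟩
  · have h := hX.holomorphic
    fin_cases a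
    · exact ((h 1).add (h (-1))).div_const _
    · exact ((h (-1)).sub (h 1)).div_const _
    · exact ((h (-I)).sub (h I)).div_const _
    · exact ((h 0).const_mul _).sub (((h 1).add (h (-1))).div_const _)
  · obtain ⟨ξ, hξ⟩ := exists_eq_flatCut_of_eth_eth_eq_zero (hX.regular τ hτ) (hX.goodCut τ hτ)
    change X τ = flatCut (flatCoords (X τ))
    rw [hξ, flatCoords_flatCut]

/-- A holomorphic function of `τ` that vanishes on the (real) curve of those `τ` for which
`X(τ, ζ)` is real vanishes identically: by the open mapping theorem that curve accumulates. -/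
lemma IsGCF.eq_zero_of_real_points {σ : ℂ → ℂ} {U : Set ℂ} {X : ℂ → ℂ → ℂ} (hX : IsGCF σ U X)
    (ζ : ℂ) {h : ℂ → ℂ} (hh : DifferentiableOn ℂ h U)
    (h0 : ∀ τ ∈ U, ∀ u : ℝ, X τ ζ = u → h τ = 0) : ∀ τ ∈ U, h τ = 0 := by
  obtain ⟨τ₀, hτ₀, hX0⟩ := hX.real ζ 0
  have hXa : AnalyticAt ℂ (fun τ => X τ ζ) τ₀ :=
    (hX.holomorphic ζ).analyticAt (hX.isOpen.mem_nhds hτ₀)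
  have hopen : 𝓝 (X τ₀ ζ) ≤ map (fun τ => X τ ζ) (𝓝 τ₀) := by
    refine hXa.eventually_constant_or_nhds_le_map_nhds.resolve_left fun hcst => ?_
    have h1 : ∀ᶠ τ in 𝓝[≠] τ₀, τ = τ₀ := by
      filter_upwards [nhdsWithin_le_nhds hcst, nhdsWithin_le_nhds (hX.isOpen.mem_nhds hτ₀)]
        with τ h1 h2
      exact hX.injective ζ h2 hτ₀ h1
    obtain ⟨τ, h2, h3⟩ := (h1.and self_mem_nhdsWithin).exists
    exact h3 h2
  have hfreq : ∃ᶠ τ in 𝓝[≠] τ₀, h τ = 0 := by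
    rw [frequently_iff]
    intro S hS
    obtain ⟨V, hV, hVS⟩ := mem_nhdsWithin_iff_exists_mem_nhds_inter.1 hS
    have him := hopen (image_mem_map (Filter.inter_mem hV (hX.isOpen.mem_nhds hτ₀)))
    rw [hX0] at him
    -- real values of `X` other than `X(τ₀)` are taken in every neighbourhood of `τ₀`
    have hseq : Tendsto (fun n : ℕ => ((1 / ((n : ℝ) + 1) : ℝ) : ℂ)) atTop (𝓝 ((0 : ℝ) : ℂ)) :=
      (continuous_ofReal.tendsto 0).comp tendsto_one_div_add_atTop_nhds_zero_nat
    obtain ⟨n, τ, ⟨hτV, hτU⟩, hτ⟩ := (hseq.eventually him).exists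
    refine ⟨τ, hVS ⟨hτV, ?_⟩, h0 τ hτU _ hτ⟩
    rintro rfl
    have h1 : X τ ζ = ((1 / ((n : ℝ) + 1) : ℝ) : ℂ) := hτ
    rw [hX0] at h1
    have : (0 : ℝ) < 1 / ((n : ℝ) + 1) := by positivity
    exact this.ne (ofReal_inj.1 h1)
  exact fun τ hτ => (hh.analyticOnNhd hX.isOpen).eqOn_zero_of_preconnected_of_frequently_eq_zero
    hX.isPreconnected hτ₀ hfreq hτ

lemma isGCF_flatCut (x y z : ℂ) :
    IsGCF (fun _ => 0) Set.univ (fun τ => flatCut ![τ, x, y, z]) := by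
  have h2 := ofReal_sqrt_two_ne_zero
  have e (τ ζ : ℂ) : flatCut ![τ, x, y, z] ζ = τ / (√2 : ℂ) + flatCut ![0, x, y, z] ζ := by
    simp [flatCut_eq]
    ring
  refine ⟨isOpen_univ, isPreconnected_univ, fun ζ => ?_, fun τ _ => smoothSpin_flatCut _,
    fun τ _ ζ => eth_eth_flatCut _ ζ, fun ζ τ _ τ' _ h => ?_, fun ζ u => ?_⟩
  · rw [show (fun τ => flatCut ![τ, x, y, z] ζ) = _ from funext fun τ => e τ ζ]
    exact ((differentiable_id.div_const _).add_const _).differentiableOn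
  · have h' := (e τ ζ).symm.trans (Eq.trans h (e τ' ζ))
    exact (div_left_inj' h2).1 (add_right_cancel h')
  · refine ⟨(√2 : ℂ) * (u - flatCut ![0, x, y, z] ζ), Set.mem_univ _, ?_⟩
    rw [e]
    field_simp
    ring

/-! ### The moments of the Kerr metric -/

/-- The expansion `r/(r² + b) = 1/r + O(r⁻³)`. -/
lemma isBigO_div_sq_add_sub_inv {b : ℝ} (hb : 0 ≤ b) :
    (fun r : ℝ => r / (r ^ 2 + b) - 1 / r) =O[atTop] fun r => (r ^ 3)⁻¹ := by
  refine IsBigO.of_bound b ?_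
  filter_upwards [eventually_gt_atTop 0] with r hr
  have e : r / (r ^ 2 + b) - 1 / r = -(b / (r * (r ^ 2 + b))) := by
    have : r ^ 2 + b ≠ 0 := by positivity
    field_simp
    ring
  rw [e, norm_neg, Real.norm_of_nonneg (by positivity), Real.norm_of_nonneg (by positivity),
    div_eq_mul_inv]
  refine mul_le_mul_of_nonneg_left (inv_anti₀ (by positivity) ?_) hb
  nlinarith

lemma hasLowMoments_kerrMetric {c G : ℝ} (hc : 0 < c) (M a : ℝ) :
    HasLowMoments c G (kerrMetric (G * M / c ^ 2) a) M ![0, 0, 0] ![0, 0, M * c * a] := by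
  refine ⟨0, fun θ φ => ⟨?_, ?_, ?_⟩⟩
  · have h := (isBigO_div_sq_add_sub_inv (b := a ^ 2 * Real.cos θ ^ 2) (by positivity)).const_mul_left
      (-(2 * (G * M / c ^ 2)))
    refine h.congr_left fun r => ?_
    simp [kerrMetric, Fin.sum_univ_three]
    ring
  · simp [kerrMetric, Fin.sum_univ_three]
    exact isBigO_zero _ _
  · have h := (isBigO_div_sq_add_sub_inv (b := a ^ 2 * Real.cos θ ^ 2) (by positivity)).const_mul_left
      (2 * (G * M / c ^ 2) * a * Real.sin θ ^ 2)
    have h32 : (fun r : ℝ => (r ^ 3)⁻¹) =O[atTop] fun r => (r ^ 2)⁻¹ := by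
      refine IsBigO.of_bound 1 ?_
      filter_upwards [eventually_ge_atTop 1] with r hr
      rw [Real.norm_of_nonneg (by positivity), Real.norm_of_nonneg (by positivity), one_mul]
      exact inv_anti₀ (by positivity) (pow_le_pow_right₀ hr (by norm_num))
    refine (h.trans h32).congr_left fun r => ?_
    simp [kerrMetric, Fin.sum_univ_three]
    field_simp
    ring

/-! ### World lines and the dipole in a shear-free frame -/

namespace ScriData

section dipole

variable {c G M : ℝ} {D : Fin 3 → ℂ} {ψ0 ψ1 : ℂ → ℂ}

lemma neg_dipoleFactor_ne_zero (hc : 0 < c) (hG : 0 < G) :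
    -((6 * √2 * G / c ^ 2 : ℝ) : ℂ) ≠ 0 := by
  refine neg_ne_zero.2 (ofReal_ne_zero.2 ?_)
  positivity

lemma nullRotPsi1_flatCut_eq_zero_iff (hc : 0 < c) (hG : 0 < G)
    (hψ1 : ∀ ζ, ψ1 ζ = ∑ i, (-((6 * √2 * G / c ^ 2 : ℝ) : ℂ) * D i) * Y11 i ζ) (ξ : Fin 4 → ℂ)
    (u : ℝ) :
    (∀ ζ, (stationaryData ψ0 ψ1 ((-(2 * √2 * G / c ^ 2) * M : ℝ) : ℂ)).nullRotPsi1
        (eth 0 (flatCut ξ)) u ζ = 0) ↔ ∀ i : Fin 3, D i = M * ξ i.succ := by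
  rw [nullRotPsi1_flatCut hψ1, sum_Y11_eq_zero_iff]
  simp only [mul_eq_zero, neg_dipoleFactor_ne_zero hc hG, false_or, sub_eq_zero]

lemma l1Coeff_nullRotPsi1_flatCut_eq_zero_iff (hc : 0 < c) (hG : 0 < G)
    (hψ1 : ∀ ζ, ψ1 ζ = ∑ i, (-((6 * √2 * G / c ^ 2 : ℝ) : ℂ) * D i) * Y11 i ζ) (ξ : Fin 4 → ℂ)
    (u : ℝ) :
    (∀ i, l1Coeff ((stationaryData ψ0 ψ1 ((-(2 * √2 * G / c ^ 2) * M : ℝ) : ℂ)).nullRotPsi1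
        (eth 0 (flatCut ξ)) u) i = 0) ↔ ∀ i : Fin 3, D i = M * ξ i.succ := by
  rw [nullRotPsi1_flatCut hψ1]
  simp only [l1Coeff_sum_Y11, mul_eq_zero, neg_dipoleFactor_ne_zero hc hG, false_or, sub_eq_zero]

/-- On the real points of null infinity `ψ₁*⁰` vanishes only if the world line satisfies
`D = M ξ`: for each direction, `ψ₁*⁰` is holomorphic in `τ`. -/
lemma nullRotPsi1_real_points_iff (hc : 0 < c) (hG : 0 < G)
    (hψ1 : ∀ ζ, ψ1 ζ = ∑ i, (-((6 * √2 * G / c ^ 2 : ℝ) : ℂ) * D i) * Y11 i ζ)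
    {σ : ℂ → ℂ} {U : Set ℂ} {X : ℂ → ℂ → ℂ} (hX : IsGCF σ U X) {ξ : ℂ → Fin 4 → ℂ}
    (hξ : ∀ a, DifferentiableOn ℂ (fun τ => ξ τ a) U) (hXξ : ∀ τ ∈ U, X τ = flatCut (ξ τ)) :
    (∀ (u : ℝ) (ζ τ : ℂ), τ ∈ U → X τ ζ = u →
        (stationaryData ψ0 ψ1 ((-(2 * √2 * G / c ^ 2) * M : ℝ) : ℂ)).nullRotPsi1
          (eth 0 (X τ)) u ζ = 0) ↔
      ∀ τ ∈ U, ∀ i : Fin 3, D i = M * ξ τ i.succ := by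
  constructor
  · intro h τ hτ
    rw [← nullRotPsi1_flatCut_eq_zero_iff (ψ0 := ψ0) hc hG hψ1 (ξ τ) 0]
    intro ζ
    rw [nullRotPsi1_flatCut hψ1]
    refine hX.eq_zero_of_real_points ζ (h := fun τ => ∑ i,
      (-((6 * √2 * G / c ^ 2 : ℝ) : ℂ) * (D i - M * ξ τ i.succ)) * Y11 i ζ) ?_ ?_ τ hτ
    · exact DifferentiableOn.fun_sum fun i _ =>
        ((((hξ i.succ).const_mul _).const_sub _).const_mul _).mul_const _
    · intro τ hτ u hu
      have := h u ζ τ hτ hu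
      rwa [hXξ τ hτ, nullRotPsi1_flatCut hψ1] at this
  · intro h u ζ τ hτ _
    rw [hXξ τ hτ]
    exact (nullRotPsi1_flatCut_eq_zero_iff hc hG hψ1 (ξ τ) u).2 (h τ hτ) ζ

end dipole

end ScriData

lemma flatCut_vec (τ x y z ζ : ℂ) : flatCut ![τ, x, y, z] ζ
    = τ / (√2 : ℂ) - 1 / 2 * (x * Y10 0 ζ + y * Y10 1 ζ + z * Y10 2 ζ) := by
  rw [flatCut_eq, Fin.sum_univ_three]
  rfl

lemma isSupertranslation_translation (b : Fin 4 → ℝ) : IsSupertranslation (translation b) := by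
  rw [IsSupertranslation, show (fun ζ => (translation b ζ : ℂ)) = _ from
    funext fun ζ => ofReal_translation b ζ]
  exact smoothSpin_flatCut _

open ScriData in
theorem mainTheorem3 (c G : ℝ) (hc : 0 < c) (hG : 0 < G) (d : ScriData)
    (hvac : d.IsVacuum) (hstat : d.IsStationary) :
    -- the field equations for time-independent data
    (∀ u ζ, d.ψ3 u ζ = 0 ∧ d.ψ4 u ζ = 0 ∧ eth 0 (d.ψ2 u) ζ = 0 ∧
      eth 1 (d.ψ1 u) ζ = 3 * d.σ u ζ * d.ψ2 u ζ ∧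
      d.ψ2 u ζ + eth (-1) (eth (-2) (d.σbar u)) ζ
        = conj (d.ψ2 u ζ) + ethBar 1 (ethBar 2 (d.σ u)) ζ) ∧
    -- the Bondi mass
    ∃ M : ℝ, (∀ u, d.bondiMass c G u = M) ∧
    (∀ u ζ, d.ψ2 u ζ = ((-(2 * √2 * G / c ^ 2) * M : ℝ) : ℂ)) ∧
    -- the magnetic part of the shear vanishes
    (∀ u, (∃ σE σM, IsElectricMagneticSplit (d.σ u) σE σM) ∧
      ∀ σE σM, IsElectricMagneticSplit (d.σ u) σE σM → ∀ ζ, σM ζ = 0) ∧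
    -- the electric part is removed by a supertranslation
    (∃ α : ℂ → ℝ, IsSupertranslation α ∧ ∀ u ζ, (d.supertranslate α).σ u ζ = 0) ∧
    -- in every Bondi frame so obtained:
    ∀ α : ℂ → ℝ, IsSupertranslation α → (∀ u ζ, (d.supertranslate α).σ u ζ = 0) →
    ∀ d' : ScriData, d' = d.supertranslate α →
      d'.IsVacuum ∧ d'.IsStationary ∧ (∀ u, d'.bondiMass c G u = M) ∧
      (∀ u ζ, d'.ψ2 u ζ = ((-(2 * √2 * G / c ^ 2) * M : ℝ) : ℂ)) ∧
      ∃ D : Fin 3 → ℂ, (∀ u i, d'.complexDipole c G u i = D i) ∧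
      -- `ψ₁⁰` is pure `l = 1`
      (∀ u ζ, d'.ψ1 u ζ = ∑ i, (-((6 * √2 * G / c ^ 2 : ℝ) : ℂ) * D i) * Y11 i ζ) ∧
      -- the regular solutions of the good cut equation are those of flat space
      (∀ g : ℂ → ℂ, SmoothSpin 0 g →
        ((∀ u ζ, eth 1 (eth 0 g) ζ = d'.σ u ζ) ↔ ∃! ξ : Fin 4 → ℂ, ∀ ζ, g ζ = flatCut ξ ζ)) ∧
      (∀ (ξ : Fin 4 → ℂ) (ζ : ℂ),
        flatCut ξ ζ = ξ 0 / (√2 : ℂ) - (1 / 2) * ∑ i : Fin 3, ξ i.succ * Y10 i ζ ∧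
        eth 0 (flatCut ξ) ζ = ∑ i : Fin 3, ξ i.succ * Y11 i ζ) ∧
      -- every good cut function comes from a complex world line, and the vanishing of `ψ₁*⁰`,
      -- or just of its `l = 1` part, is the relation `D = M ξ`
      (∀ (U : Set ℂ) (X : ℂ → ℂ → ℂ), IsGCF (d'.σ 0) U X →
        ∃ ξ : ℂ → Fin 4 → ℂ, (∀ a, DifferentiableOn ℂ (fun τ => ξ τ a) U) ∧
          (∀ τ ∈ U, ∀ ζ, X τ ζ = flatCut (ξ τ) ζ) ∧
          (∀ τ ∈ U, ∀ u : ℝ,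
            ((∀ i, l1Coeff (d'.nullRotPsi1 (eth 0 (X τ)) u) i = 0) ↔
              ∀ i : Fin 3, D i = M * ξ τ i.succ) ∧
            ((∀ ζ, d'.nullRotPsi1 (eth 0 (X τ)) u ζ = 0) ↔
              ∀ i : Fin 3, D i = M * ξ τ i.succ)) ∧
          ((∀ (u : ℝ) (ζ τ : ℂ), τ ∈ U → X τ ζ = u →
              d'.nullRotPsi1 (eth 0 (X τ)) u ζ = 0) ↔
            ∀ τ ∈ U, ∀ i : Fin 3, D i = M * ξ τ i.succ)) ∧
      (M ≠ 0 →
        -- the universal cut function exists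
        (∃ X, IsGCF (d'.σ 0) Set.univ X ∧ d'.IsUCF Set.univ X) ∧
        ∃ x : Fin 3 → ℂ, (∀ i, D i = M * x i) ∧
        (∀ u i, d'.massDipole c G u i = M * (x i).re ∧
          d'.angularMomentum c G u i = M * c * (x i).im) ∧
        -- a real spatial translation, followed by a rotation
        ∃ (A : Matrix (Fin 2) (Fin 2) ℂ) (a : ℝ) (d'' : ScriData),
          A ∈ Matrix.specialUnitaryGroup (Fin 2) ℂ ∧ 0 ≤ a ∧ a ^ 2 = ∑ i, (x i).im ^ 2 ∧
          (d'.supertranslate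
            (translation ![0, -(x 0).re, -(x 1).re, -(x 2).re])).IsRotated A d'' ∧
          d''.IsVacuum ∧ d''.IsStationary ∧ (∀ u ζ, d''.σ u ζ = 0) ∧
          (∀ u, d''.bondiMass c G u = M) ∧
          -- every universal cut function has constant spatial part, and takes the canonical form
          -- in the new frame and the gauge `τ ↦ ξ⁰(τ)`
          (∀ (U : Set ℂ) (X : ℂ → ℂ → ℂ), IsGCF (d'.σ 0) U X → d'.IsUCF U X →
            ∃ ξ0 : ℂ → ℂ, DifferentiableOn ℂ ξ0 U ∧ Set.InjOn ξ0 U ∧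
              (∀ τ ∈ U, ∀ ζ, X τ ζ = flatCut ![ξ0 τ, x 0, x 1, x 2] ζ) ∧
              ∀ τ ∈ U, ∀ ζ, mobDenom A ζ ≠ 0 →
                flatCut ![ξ0 τ, 0, 0, I * a] (mob A ζ)
                  = X τ ζ + translation ![0, -(x 0).re, -(x 1).re, -(x 2).re] ζ) ∧
          (∀ τ ζ : ℂ,
            flatCut ![τ, 0, 0, I * a] ζ = τ / (√2 : ℂ) - I / 2 * a * Y10 2 ζ ∧
            eth 0 (flatCut ![τ, 0, 0, I * a]) ζ = I * a * Y11 2 ζ) ∧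
          -- it is the universal cut function of the new frame
          IsGCF (d''.σ 0) Set.univ (fun τ => flatCut ![τ, 0, 0, I * a]) ∧
          d''.IsUCF Set.univ (fun τ => flatCut ![τ, 0, 0, I * a]) ∧
          (∀ (τ : ℂ) (u : ℝ) (ζ : ℂ),
            d''.nullRotPsi1 (eth 0 (flatCut ![τ, 0, 0, I * a])) u ζ = 0) ∧
          -- the moments in the new frame, which are those of the Kerr metric
          (∀ u, d''.massDipole c G u = ![0, 0, 0] ∧
            d''.angularMomentum c G u = ![0, 0, M * c * a]) ∧
          ∀ u, HasLowMoments c G (kerrMetric (G * M / c ^ 2) a)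
            (d''.bondiMass c G u) (d''.massDipole c G u) (d''.angularMomentum c G u)) := by
  have hstd := hvac.stationary_equations hstat
  refine ⟨fun u ζ => ⟨(hstd u ζ).1, (hstd u ζ).2.1, (hstd u ζ).2.2.1, (hstd u ζ).2.2.2, ?_⟩, ?_⟩
  · have h := hvac.reality u ζ
    rw [massAspect_of_stationary hstat] at h
    simp only [map_add, conj_eth_eth_σbar] at h
    exact h.symm
  obtain ⟨M, hM, hψ2⟩ := hvac.exists_bondiMass hstat hc hG
  obtain ⟨e, he, hσe⟩ := exists_potential (smoothSpin_of_field hvac.smooth_σ 0)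
    (hvac.conj_ethBar_ethBar_σ hstat 0)
  have hσ0 (u : ℝ) (ζ : ℂ) : d.σ u ζ = eth 1 (eth 0 fun w => (e w : ℂ)) ζ := by
    rw [hσe, (hstat u 0 ζ).1]
  refine ⟨M, hM, hψ2, fun u => ⟨⟨d.σ u, fun _ => 0, e, fun _ => 0, he, ?_, hσ0 u, fun ζ => ?_,
    fun ζ => (add_zero _).symm⟩, ?_⟩, ⟨fun ζ => -e ζ, ?_, fun u ζ => ?_⟩, ?_⟩
  · simpa using SmoothSpin.zero 0
  · simp only [ofReal_zero]
    rw [show (eth 0 fun _ => (0 : ℂ)) = fun _ => 0 from funext fun _ => eth_zero_fun _,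
      eth_zero_fun, mul_zero]
  · -- two splittings of `σ⁰` differ by real potentials with `ð²(e₁ - e) + i ð²b = 0`
    rintro σE σM ⟨e₁, b, he₁, hb, hE, hB, hsum⟩ ζ
    have hdiff : SmoothSpin 0 (fun ζ => ((e₁ ζ - e ζ : ℝ) : ℂ)) := by
      simpa using he₁.sub he
    rw [hB, magnetic_eq_zero hdiff hb ?_ ζ, mul_zero]
    intro z
    have h1 := hsum z
    rw [hσ0, hE, hB] at h1
    have h2 : (fun w => ((e₁ w - e w : ℝ) : ℂ)) = fun w => (e₁ w : ℂ) + (-1) * (e w : ℂ) := by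
      ext1 w; push_cast; ring
    rw [h2, eth_eth_add he₁ (he.const_mul (-1)), eth_eth_const_mul _ he, h1]
    ring
  · simpa [IsSupertranslation] using he.const_mul (-1)
  · have h2 : (fun w => ((-e w : ℝ) : ℂ)) = fun w => (-1) * (e w : ℂ) := by
      ext1 w; push_cast; ring
    simp only [supertranslate]
    rw [h2, eth_eth_const_mul _ he, hσ0]
    ring
  intro α hα hσα d' hd'
  obtain ⟨ψ0, ψ1, h0, h1, h1e, -, hd'eq⟩ := hvac.supertranslate_eq hstat hψ2 hα hσα
  obtain rfl : d' = _ := hd'.trans hd'eq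
  have hv' := isVacuum_stationaryData (-(2 * √2 * G / c ^ 2) * M) h0 h1 h1e
  have hs' := isStationary_stationaryData ψ0 ψ1 ((-(2 * √2 * G / c ^ 2) * M : ℝ) : ℂ)
  obtain ⟨a₁, ha₁⟩ := exists_eq_sum_Y11_of_eth_eq_zero h1 h1e
  have hκ := neg_dipoleFactor_ne_zero hc hG
  obtain ⟨D, hD⟩ : ∃ D : Fin 3 → ℂ, ∀ ζ,
      ψ1 ζ = ∑ i, (-((6 * √2 * G / c ^ 2 : ℝ) : ℂ) * D i) * Y11 i ζ :=
    ⟨fun i => a₁ i / -((6 * √2 * G / c ^ 2 : ℝ) : ℂ), fun ζ => by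
      simp only [ha₁, mul_div_cancel₀ _ hκ]⟩
  have hdip (u : ℝ) (i : Fin 3) := complexDipole_of_ψ1 hc hG (u := u)
    (d := stationaryData ψ0 ψ1 ((-(2 * √2 * G / c ^ 2) * M : ℝ) : ℂ)) hD i
  refine ⟨hv', hs', hv'.bondiMass_eq hs' hc hG fun _ _ => rfl, fun _ _ => rfl, D, hdip,
    fun u => hD, fun g hg => ⟨fun h => ?_, ?_⟩, fun ξ ζ => ⟨flatCut_eq ξ ζ, eth_flatCut ξ ζ⟩,
    fun U X hX => ?_, fun hM0 => ?_⟩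
  · obtain ⟨ξ, hξ⟩ := exists_eq_flatCut_of_eth_eth_eq_zero hg (h 0)
    exact ⟨ξ, fun ζ => congrFun hξ ζ,
      fun ξ' hξ' => flatCut_injective ((funext hξ').symm.trans hξ)⟩
  · rintro ⟨ξ, hξ, -⟩ u ζ
    rw [show g = flatCut ξ from funext hξ, eth_eth_flatCut]
    rfl
  · obtain ⟨ξ, hξ, hXξ⟩ := IsGCF.exists_worldLine hX
    refine ⟨ξ, hξ, fun τ hτ ζ => congrFun (hXξ τ hτ) ζ, fun τ hτ u => ?_,
      nullRotPsi1_real_points_iff hc hG hD hX hξ hXξ⟩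
    rw [hXξ τ hτ]
    exact ⟨l1Coeff_nullRotPsi1_flatCut_eq_zero_iff hc hG hD _ u,
      nullRotPsi1_flatCut_eq_zero_iff hc hG hD _ u⟩
  have hMc : (M : ℂ) ≠ 0 := ofReal_ne_zero.2 hM0
  obtain ⟨x, hx⟩ : ∃ x : Fin 3 → ℂ, ∀ i, D i = M * x i :=
    ⟨fun i => D i / M, fun i => (mul_div_cancel₀ _ hMc).symm⟩
  refine ⟨⟨fun τ => flatCut ![τ, x 0, x 1, x 2], isGCF_flatCut _ _ _, fun τ _ u =>
    (l1Coeff_nullRotPsi1_flatCut_eq_zero_iff hc hG hD _ u).2 fun i => ?_⟩, x, hx,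
    fun u i => ⟨?_, ?_⟩, ?_⟩
  · rw [hx]
    fin_cases i <;> rfl
  · rw [massDipole, hdip, hx, re_ofReal_mul]
  · rw [angularMomentum, hdip, hx, im_ofReal_mul]
    ring
  obtain ⟨A, a, hA, ha0, ha2, hY10, hY11⟩ := exists_rotation_to_axis fun i => (x i).im
  set b : Fin 4 → ℝ := ![0, -(x 0).re, -(x 1).re, -(x 2).re] with hb
  have hbz (ζ : ℂ) : (translation b ζ : ℂ)
      = 1 / 2 * ((x 0).re * Y10 0 ζ + (x 1).re * Y10 1 ζ + (x 2).re * Y10 2 ζ) := by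
    rw [ofReal_translation, show (fun i => (b i : ℂ))
      = ![((0 : ℝ) : ℂ), ((-(x 0).re : ℝ) : ℂ), ((-(x 1).re : ℝ) : ℂ), ((-(x 2).re : ℝ) : ℂ)] by
        ext i; fin_cases i <;> rfl, flatCut_vec]
    push_cast
    ring
  have htr : (fun ζ => (translation b ζ : ℂ)) = flatCut fun i => (b i : ℂ) :=
    funext fun ζ => ofReal_translation b ζ
  have hσt : ∀ u ζ, ((stationaryData ψ0 ψ1
      ((-(2 * √2 * G / c ^ 2) * M : ℝ) : ℂ)).supertranslate (translation b)).σ u ζ = 0 := by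
    intro u ζ
    simp only [supertranslate, stationaryData, zero_add]
    rw [htr, eth_eth_flatCut]
  obtain ⟨φ0, φ1, g0, g1, g1e, hφ1, hdt⟩ := hv'.supertranslate_eq hs' (fun _ _ => rfl)
    (isSupertranslation_translation b) hσt
  obtain ⟨ρ, hρ, hρrot⟩ := g0.exists_rotated A (Matrix.mem_specialUnitaryGroup_iff.1 hA).2
  -- the translation removes the real part of the dipole, the rotation aligns the imaginary part
  set D₂ : Fin 3 → ℂ := ![0, 0, M * (I * a)] with hD₂
  set ρ1 : ℂ → ℂ := fun ζ => ∑ i, (-((6 * √2 * G / c ^ 2 : ℝ) : ℂ) * D₂ i) * Y11 i ζ with hρ1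
  have hρ1' (ζ : ℂ) : ρ1 ζ = (-((6 * √2 * G / c ^ 2 : ℝ) : ℂ) * M * I) * (a * Y11 2 ζ) := by
    simp only [hρ1, hD₂, Fin.sum_univ_three, Matrix.cons_val]
    ring
  have hφ1' (ζ : ℂ) : φ1 ζ = (-((6 * √2 * G / c ^ 2 : ℝ) : ℂ) * M * I)
      * ∑ i, ((x i).im : ℂ) * Y11 i ζ := by
    have hxi (i : Fin 3) : x i = (x i).re + (x i).im * I := (re_add_im (x i)).symm
    have hb1 : b (Fin.succ 0) = -(x 0).re := rfl
    have hb2 : b (Fin.succ 1) = -(x 1).re := rfl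
    have hb3 : b (Fin.succ 2) = -(x 2).re := rfl
    rw [hφ1]
    simp only [stationaryData, hD, htr, eth_flatCut, hx, Fin.sum_univ_three, hb1, hb2, hb3]
    push_cast
    linear_combination (-(6 * (√2 : ℂ) * G / c ^ 2) * M) * (Y11 0 ζ * hxi 0 + Y11 1 ζ * hxi 1
      + Y11 2 ζ * hxi 2)
  have hρ1s : SmoothSpin 1 ρ1 :=
    SmoothSpin.sum Finset.univ fun i _ => (smoothSpin_Y11 i).const_mul _
  have hv'' := isVacuum_stationaryData (-(2 * √2 * G / c ^ 2) * M) hρ hρ1s (eth_sum_Y11 _)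
  have hs'' := isStationary_stationaryData ρ ρ1 ((-(2 * √2 * G / c ^ 2) * M : ℝ) : ℂ)
  have hM'' := hv''.bondiMass_eq hs'' hc hG fun _ _ => rfl
  have hdip'' (u : ℝ) (i : Fin 3) := complexDipole_of_ψ1 hc hG (u := u)
    (d := stationaryData ρ ρ1 ((-(2 * √2 * G / c ^ 2) * M : ℝ) : ℂ)) (fun _ => rfl) i
  have hDξ (τ : ℂ) (i : Fin 3) : D₂ i = M * ![τ, 0, 0, I * a] i.succ := by
    fin_cases i <;> simp [hD₂]
  have hmass (u : ℝ) : (stationaryData ρ ρ1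
      ((-(2 * √2 * G / c ^ 2) * M : ℝ) : ℂ)).massDipole c G u = ![0, 0, 0] := by
    ext i
    rw [massDipole, hdip'']
    fin_cases i <;> simp [hD₂]
  have hang (u : ℝ) : (stationaryData ρ ρ1
      ((-(2 * √2 * G / c ^ 2) * M : ℝ) : ℂ)).angularMomentum c G u = ![0, 0, M * c * a] := by
    ext i
    rw [angularMomentum, hdip'']
    fin_cases i <;> simp [hD₂]
    ring
  refine ⟨A, a, _, hA, ha0, ha2, ?_, hv'', hs'', fun _ _ => rfl, hM'', ?_, fun τ ζ => ⟨?_, ?_⟩,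
    isGCF_flatCut _ _ _, fun τ _ u =>
      (l1Coeff_nullRotPsi1_flatCut_eq_zero_iff hc hG (fun _ => rfl) _ u).2 (hDξ τ),
    fun τ u => (nullRotPsi1_flatCut_eq_zero_iff hc hG (fun _ => rfl) _ u).2 (hDξ τ),
    fun u => ⟨hmass u, hang u⟩, fun u => ?_⟩
  · rw [hdt]
    refine fun u => ⟨fun ζ _ => ?_, hρrot, fun ζ hζ => ?_, fun ζ _ => ?_, fun ζ _ => ?_,
      fun ζ _ => ?_⟩
    · simp [stationaryData]
    · have := hY11 ζ hζ
      simp only [stationaryData, hρ1', hφ1', this]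
      ring
    · simp [stationaryData]
    · simp [stationaryData]
    · simp [stationaryData]
  · intro U X hX hucf
    obtain ⟨ξ, hξ, hXξ⟩ := IsGCF.exists_worldLine hX
    have hsp (τ : ℂ) (hτ : τ ∈ U) (i : Fin 3) : ξ τ i.succ = x i := by
      have h := hucf τ hτ 0
      rw [hXξ τ hτ, l1Coeff_nullRotPsi1_flatCut_eq_zero_iff hc hG hD] at h
      exact mul_left_cancel₀ hMc ((h i).symm.trans (hx i))
    have hX' (τ : ℂ) (hτ : τ ∈ U) : X τ = flatCut ![ξ τ 0, x 0, x 1, x 2] := by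
      rw [hXξ τ hτ]
      congr 1
      ext i
      refine Fin.cases rfl (fun j => ?_) i
      rw [hsp τ hτ]
      fin_cases j <;> rfl
    refine ⟨fun τ => ξ τ 0, hξ 0, fun τ hτ τ' hτ' h => hX.injective 0 hτ hτ' ?_,
      fun τ hτ ζ => congrFun (hX' τ hτ) ζ, fun τ hτ ζ hζ => ?_⟩
    · simp only at h ⊢
      rw [hX' τ hτ, hX' τ' hτ', h]
    · have hxi (i : Fin 3) : x i = (x i).re + (x i).im * I := (re_add_im (x i)).symm
      have h := hY10 ζ hζ
      rw [Fin.sum_univ_three] at h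
      rw [hX' τ hτ, hbz, flatCut_vec, flatCut_vec]
      linear_combination (-I / 2) * h + 1 / 2 * (Y10 0 ζ * hxi 0 + Y10 1 ζ * hxi 1
        + Y10 2 ζ * hxi 2)
  · rw [flatCut_vec]
    ring
  · rw [eth_flatCut]
    simp [Fin.sum_univ_three]
  · rw [hM'', hmass, hang]
    exact hasLowMoments_kerrMetric hc M a
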